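/- Let $a>0$ and $\lambda>0$. Write $\widehat\psi(k)=\int_{\mathbb R}e^{-2i\pi uk}\psi(u)\,du$, let $\sqrt z$ denote the principal square root of $z\in\mathbb C$, and let $\mathcal S(\mathbb R)$ be the Schwartz space. For $\varphi\in\mathcal S(\mathbb R)$ define $\mathcal L\varphi$ by $$\widehat{\mathcal L\varphi}(k)=\frac{1}{2\sqrt{3\lambda}}\,\frac{(2i\pi k)^2}{\sqrt{a+i\pi k}}\;\widehat\varphi(k),\qquad k\in\mathbb R.$$ 1. The operator $\mathcal L$ maps $\mathcal S(\mathbb R)$ into itself, and it maps real-valued functions to real-valued functions. 2. The operator $\mathcal L$ is the generator of a Lévy process: there is a real Lévy process $(X_t)_{t\ge0}$ (that is, $X_0=0$ almost surely, the increments are independent and stationary, and $X$ is continuous in probability) such that, for every $\varphi\in\mathcal S(\mathbb R)$, $\frac1t\big(\mathbb E[\varphi(u+X_t)]-\varphi(u)\big)\to\mathcal L\varphi(u)$ uniformly in $u\in\mathbb R$ as $t\downarrow0$, and the generator on $C_0(\mathbb R)$ of the transition semigroup $P_tf(u)=\mathbb E[f(u+X_t)]$ is the closure in $C_0(\mathbb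 R)\times C_0(\mathbb R)$ of $\mathcal L$ with domain $\mathcal S(\mathbb R)$. Here $C_0(\mathbb R)$ is the space of continuous functions vanishing at infinity, with the supremum norm. 3. The measure $$\Pi_a(dy)=\frac{4a^{5/2}}{\sqrt{6\lambda\pi}}\;e^{-2ay}\left[\frac{3}{16(ay)^{5/2}}+\frac{1}{2(ay)^{3/2}}+\frac{1}{(ay)^{1/2}}\right]\mathbf 1_{(0,+\infty)}(y)\,dy$$ is a Lévy measure on $\mathbb R$ (that is, $\Pi_a(\{0\})=0$ and $\int\min(1,y^2)\,\Pi_a(dy)<\infty$), and $\mathcal L$ has the Lévy–Khintchine representation $$(\mathcal L\varphi)(u)=\int_{\mathbb R}\big[\varphi(u-y)-\varphi(u)+y\varphi'(u)\big]\,\Pi_a(dy),\qquad \varphi\in\mathcal S(\mathbb R),\ u\in\mathbb R,$$ where the integral converges absolutely. -/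

import Mathlib

open MeasureTheory ProbabilityTheory Filter Topology
open scoped FourierTransform SchwartzMap NNReal ENNReal ZeroAtInfty

noncomputable section

/-- The Fourier multiplier `(2iπk)² / (2 √(3λ) √(a + iπk))`, with the principal complex square
root. -/
def levySymbol (a lam k : ℝ) : ℂ :=
  1 / (2 * (Real.sqrt (3 * lam) : ℂ)) *
    ((2 * Complex.I * Real.pi * k) ^ 2 / Complex.sqrt (a + Complex.I * Real.pi * k))

/-- The operator `𝓛` on Schwartz functions: the function whose Fourier transform is
`levySymbol · 𝓕 φ`, given by Fourier inversion. The Fourier transform of Mathlib is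
`𝓕 ψ k = ∫ exp (-2iπuk) ψ u du`. -/
def levyOp (a lam : ℝ) (φ : 𝓢(ℝ, ℂ)) : ℝ → ℂ :=
  𝓕⁻ (fun k : ℝ => levySymbol a lam k * 𝓕 (φ : ℝ → ℂ) k)

/-- The density of the measure `Π_a` on `(0, ∞)`. -/
def levyDensity (a lam y : ℝ) : ℝ :=
  4 * a ^ (5 / 2 : ℝ) / Real.sqrt (6 * lam * Real.pi) * Real.exp (-2 * a * y) *
    (3 / (16 * (a * y) ^ (5 / 2 : ℝ)) + 1 / (2 * (a * y) ^ (3 / 2 : ℝ)) + 1 / (a * y) ^ (1 / 2 : ℝ))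

/-- The measure `Π_a` on `ℝ`. -/
def levyPi (a lam : ℝ) : Measure ℝ :=
  (volume.restrict (Set.Ioi 0)).withDensity (fun y => ENNReal.ofReal (levyDensity a lam y))

/-- A Lévy measure on `ℝ`: no mass at `0` and `∫ min(1, y²) dμ < ∞`. -/
def IsLevyMeasure (μ : Measure ℝ) : Prop :=
  μ {0} = 0 ∧ ∫⁻ y, ENNReal.ofReal (min 1 (y ^ 2)) ∂μ < ∞

/-- A real Lévy process: it starts at `0` almost surely, has independent and stationary increments,
and is stochastically continuous. -/
structure IsLevyProcess {Ω : Type*} [MeasurableSpace Ω] (X : ℝ≥0 → Ω → ℝ) (P : Measure Ω) :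
    Prop where
  measurable : ∀ t, Measurable (X t)
  start_zero : ∀ᵐ ω ∂P, X 0 ω = 0
  indep_increments : HasIndepIncrements X P
  stationary_increments :
    ∀ s t : ℝ≥0, IdentDistrib (fun ω => X (s + t) ω - X s ω) (X t) P P
  stochastically_continuous : ∀ t : ℝ≥0, TendstoInMeasure P X (𝓝 t) (X t)

/-- The graph, in `C₀(ℝ) × C₀(ℝ)`, of the infinitesimal generator of the transition semigroup
`(P_t f)(u) = E[f(u + X_t)]`: the pairs `(f, g)` such that `(P_t f - f) / t` converges to `g`
uniformly on `ℝ` as `t ↓ 0`. -/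
def generatorGraph {Ω : Type*} [MeasurableSpace Ω] (X : ℝ≥0 → Ω → ℝ) (P : Measure Ω) :
    Set (C₀(ℝ, ℂ) × C₀(ℝ, ℂ)) :=
  {p | TendstoUniformly
    (fun (t : ℝ≥0) (u : ℝ) => ((∫ ω, p.1 (u + X t ω) ∂P) - p.1 u) / ((t : ℝ) : ℂ))
    p.2 (𝓝[>] 0)}

/-- The graph of `𝓛` on the Schwartz space, seen in `C₀(ℝ) × C₀(ℝ)`. -/
def levyOpGraph (a lam : ℝ) : Set (C₀(ℝ, ℂ) × C₀(ℝ, ℂ)) :=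
  {p | ∃ φ : 𝓢(ℝ, ℂ), (∀ u, p.1 u = φ u) ∧ ∀ u, p.2 u = levyOp a lam φ u}

end

/-! Everything rests on one identity. With h(y) = y^(-1/2) exp(-2ay), the density of Π_a is
(6λπ)^(-1/2) h''. The Laplace transform of y^(-1/2) at r with Re r > 0 is √(π/r). Two integrations
by parts against the compensated exponential exp(iθy) - 1 - iθy at θ = -2πk bring out (iθ)² and a
multiple of (a + iπk)^(-1/2). Hence the symbol ψ is the Lévy–Khintchine exponent of Π_a
(`levySymbol_eq_integral`), and Re ψ ≤ 0 because cos ≤ 1. As y² is integrable for Π_a, full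
compensation is allowed and no truncation is needed.

Regularity is algebraic: k, (a + iπk)^(-1/2) and (1 - ψ)^(-1) generate an algebra stable under
differentiation, and each is polynomially bounded. So ψ and (1 - ψ)^(-1) have temperate growth, and
both 𝓛 and (1 - 𝓛)^(-1) act on the Schwartz space. The integral formula for 𝓛 follows by Fubini in
Fourier space, and the preservation of real functions follows from that formula.

The process is built from its finite-dimensional laws, which are those of integrals of -y
1_{(0,t]}(s) against a compensated Poisson measure of intensity ds ⊗ Π_a. Their characteristic
functions are limits of shifted compound Poisson ones (`isCharFun_exp_integral_compExp`), and
Kolmogorov extension glues the laws together. Disjoint time intervals make the exponent additive,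
which gives independent stationary increments.

For the generator, P_t multiplies 𝓕 φ by exp(tψ), and |exp z - 1 - z| ≤ |z|² on the left half-plane
gives a uniform Taylor estimate on Schwartz functions. A mean value inequality and strong continuity
carry it to the closure of 𝓛. Conversely the generator is dissipative and 1 - 𝓛 maps the Schwartz
space onto itself, which is dense in C₀, so the generator is no larger than the closure. -/

/-! ### Temperate growth of functions in differential algebras -/

/-- If the functions of a family `S` are polynomially bounded and their derivatives lie in the
algebra generated by `S`, then every element of this algebra has temperate growth. -/
theorem hasTemperateGrowth_of_mem_adjoin {S : Set (ℝ → ℂ)}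
    (hd : ∀ f ∈ S, Differentiable ℝ f)
    (hS : ∀ f ∈ S, deriv f ∈ Algebra.adjoin ℂ S)
    (hb : ∀ f ∈ S, ∃ (k : ℕ) (C : ℝ), ∀ x, ‖f x‖ ≤ C * (1 + ‖x‖) ^ k)
    {f : ℝ → ℂ} (hf : f ∈ Algebra.adjoin ℂ S) : Function.HasTemperateGrowth f := by
  have key : ∀ f ∈ Algebra.adjoin ℂ S, Differentiable ℝ f ∧ deriv f ∈ Algebra.adjoin ℂ S ∧
      ∃ (k : ℕ) (C : ℝ), ∀ x, ‖f x‖ ≤ C * (1 + ‖x‖) ^ k := by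
    intro f hf
    induction hf using Algebra.adjoin_induction with
    | mem f hf => exact ⟨hd f hf, hS f hf, hb f hf⟩
    | algebraMap r =>
      have h : (algebraMap ℂ (ℝ → ℂ) r) = fun _ => r := rfl
      rw [h]
      refine ⟨differentiable_const _, ?_, 0, ‖r‖, fun x => by simp⟩
      have : deriv (fun _ : ℝ => r) = 0 := by ext; simp
      rw [this]
      exact zero_mem _
    | add f g hf hg ihf ihg =>
      obtain ⟨df, mf, k, C, hC⟩ := ihf
      obtain ⟨dg, mg, l, D, hD⟩ := ihg
      refine ⟨df.add dg, ?_, k + l, |C| + |D|, fun x => ?_⟩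
      · have : deriv (f + g) = deriv f + deriv g := by
          ext x; exact deriv_add (df x) (dg x)
        rw [this]
        exact add_mem mf mg
      · have h1 : (1 : ℝ) ≤ 1 + ‖x‖ := by simp
        calc ‖f x + g x‖ ≤ ‖f x‖ + ‖g x‖ := norm_add_le _ _
          _ ≤ C * (1 + ‖x‖) ^ k + D * (1 + ‖x‖) ^ l := add_le_add (hC x) (hD x)
          _ ≤ |C| * (1 + ‖x‖) ^ (k + l) + |D| * (1 + ‖x‖) ^ (k + l) := by
            gcongr
            · exact le_abs_self C
            · exact Nat.le_add_right k l
            · exact le_abs_self D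
            · exact Nat.le_add_left l k
          _ = _ := by ring
    | mul f g hf hg ihf ihg =>
      obtain ⟨df, mf, k, C, hC⟩ := ihf
      obtain ⟨dg, mg, l, D, hD⟩ := ihg
      refine ⟨df.mul dg, ?_, k + l, C * D, fun x => ?_⟩
      · have : deriv (f * g) = deriv f * g + f * deriv g := by
          ext x; exact deriv_mul (df x) (dg x)
        rw [this]
        exact add_mem (mul_mem mf hg) (mul_mem hf mg)
      · calc ‖f x * g x‖ = ‖f x‖ * ‖g x‖ := norm_mul _ _
          _ ≤ (C * (1 + ‖x‖) ^ k) * (D * (1 + ‖x‖) ^ l) :=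
            mul_le_mul (hC x) (hD x) (norm_nonneg _) ((norm_nonneg _).trans (hC x))
          _ = _ := by ring
  have hiter : ∀ n : ℕ, ∀ f ∈ Algebra.adjoin ℂ S, iteratedDeriv n f ∈ Algebra.adjoin ℂ S := by
    intro n
    induction n with
    | zero => intro f hf; simpa using hf
    | succ n ih =>
      intro f hf
      rw [iteratedDeriv_succ']
      exact ih _ (key f hf).2.1
  refine ⟨contDiff_of_differentiable_iteratedDeriv fun n _ => (key _ (hiter n f hf)).1,
    fun n => ?_⟩
  obtain ⟨k, C, h⟩ := (key _ (hiter n f hf)).2.2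
  exact ⟨k, C, fun x => by rw [norm_iteratedFDeriv_eq_norm_iteratedDeriv]; exact h x⟩

/-! ### The symbol of the operator -/

section Symbol

variable {a lam : ℝ}

theorem add_I_pi_mul_mem_slitPlane (ha : 0 < a) (k : ℝ) :
    (a + Complex.I * Real.pi * k : ℂ) ∈ Complex.slitPlane :=
  Or.inl (by simpa using ha)

/-- The derivative is again a polynomial in the function itself, which is what makes the algebra of
symbols differentially closed. -/
theorem hasDerivAt_inv_sqrt_add (ha : 0 < a) (k : ℝ) :
    HasDerivAt (fun k : ℝ => (Complex.sqrt (a + Complex.I * Real.pi * k))⁻¹)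
      (-(Complex.I * Real.pi / 2) * ((Complex.sqrt (a + Complex.I * Real.pi * k))⁻¹) ^ 3) k := by
  have hz := add_I_pi_mul_mem_slitPlane ha k
  have hz0 : (a + Complex.I * Real.pi * k : ℂ) ≠ 0 := Complex.slitPlane_ne_zero hz
  have h1 : HasDerivAt (fun k : ℝ => (a + Complex.I * Real.pi * k : ℂ)) (Complex.I * Real.pi) k := by
    simpa using (((hasDerivAt_id k).ofReal_comp).const_mul (Complex.I * Real.pi : ℂ)).const_add (a : ℂ)
  have h2 := (Complex.hasDerivAt_sqrt hz).comp k h1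
  have hne : Complex.sqrt (a + Complex.I * Real.pi * k) ≠ 0 := by
    rw [Complex.sqrt, Complex.cpow_ne_zero_iff_of_exponent_ne_zero (by norm_num)]
    exact hz0
  refine (h2.inv hne).congr_deriv ?_
  have h3 : (a + Complex.I * Real.pi * k : ℂ) ^ (-1 / 2 : ℂ)
      = (Complex.sqrt (a + Complex.I * Real.pi * k))⁻¹ := by
    rw [Complex.sqrt, ← Complex.cpow_neg]; norm_num
  simp only [Function.comp_apply]
  rw [h3]
  field_simp

theorem norm_inv_sqrt_add_le (ha : 0 < a) (k : ℝ) :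
    ‖(Complex.sqrt (a + Complex.I * Real.pi * k))⁻¹‖ ≤ (Real.sqrt a)⁻¹ := by
  have h1 : a ≤ ‖(a + Complex.I * Real.pi * k : ℂ)‖ := by
    simpa using Complex.re_le_norm (a + Complex.I * Real.pi * k : ℂ)
  have h2 : ‖Complex.sqrt (a + Complex.I * Real.pi * k)‖
      = Real.sqrt ‖(a + Complex.I * Real.pi * k : ℂ)‖ := by
    rw [Complex.sqrt, Real.sqrt_eq_rpow, ← Complex.norm_cpow_real]
    norm_num
  rw [norm_inv, h2]
  gcongr

theorem levySymbol_eq_mul (a lam k : ℝ) :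
    levySymbol a lam k = (1 / (2 * (Real.sqrt (3 * lam) : ℂ)) * (2 * Complex.I * Real.pi) ^ 2) *
      (k ^ 2 * (Complex.sqrt (a + Complex.I * Real.pi * k))⁻¹) := by
  rw [levySymbol]; ring

/-- The generators X, W, G satisfy X' = 1, W' = const · W³ and G' = ψ' G², with ψ' a polynomial in X
and W; X grows linearly while W and G are bounded. Putting the resolvent among the generators treats
both functions at once. -/
theorem hasTemperateGrowth_levySymbol_and_resolvent (ha : 0 < a)
    (hre : ∀ k, (levySymbol a lam k).re ≤ 0) :
    Function.HasTemperateGrowth (levySymbol a lam) ∧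
      Function.HasTemperateGrowth (fun k => (1 - levySymbol a lam k)⁻¹) := by
  set X : ℝ → ℂ := fun k => (k : ℂ) with hX
  set W : ℝ → ℂ := fun k => (Complex.sqrt (a + Complex.I * Real.pi * k))⁻¹ with hW
  set G : ℝ → ℂ := fun k => (1 - levySymbol a lam k)⁻¹ with hG
  set c : ℂ := 1 / (2 * (Real.sqrt (3 * lam) : ℂ)) * (2 * Complex.I * Real.pi) ^ 2 with hc
  set S : Set (ℝ → ℂ) := {X, W, G} with hS
  have hXm : X ∈ Algebra.adjoin ℂ S := Algebra.subset_adjoin (by simp [hS])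
  have hWm : W ∈ Algebra.adjoin ℂ S := Algebra.subset_adjoin (by simp [hS])
  have hGm : G ∈ Algebra.adjoin ℂ S := Algebra.subset_adjoin (by simp [hS])
  have hψ : levySymbol a lam = c • (X ^ 2 * W) := by
    ext k
    rw [levySymbol_eq_mul]
    simp [hX, hW, hc]
  have hψm : levySymbol a lam ∈ Algebra.adjoin ℂ S := by
    rw [hψ]
    exact Subalgebra.smul_mem _ (mul_mem (pow_mem hXm 2) hWm) c
  have dX : ∀ k, HasDerivAt X 1 k := fun k => by simpa using (hasDerivAt_id k).ofReal_comp
  have dW : ∀ k, HasDerivAt W (-(Complex.I * Real.pi / 2) * W k ^ 3) k :=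
    fun k => hasDerivAt_inv_sqrt_add ha k
  set ψ' : ℝ → ℂ := c • ((2 : ℂ) • (X * W) + X ^ 2 * ((-(Complex.I * Real.pi / 2)) • W ^ 3)) with hψ'
  have dψ : ∀ k, HasDerivAt (levySymbol a lam) (ψ' k) k := fun k => by
    rw [hψ]
    refine ((((dX k).pow 2).mul (dW k)).const_smul c).congr_deriv ?_
    simp [hψ']
    ring
  have hψ'm : ψ' ∈ Algebra.adjoin ℂ S :=
    Subalgebra.smul_mem _ (add_mem (Subalgebra.smul_mem _ (mul_mem hXm hWm) _)
      (mul_mem (pow_mem hXm 2) (Subalgebra.smul_mem _ (pow_mem hWm 3) _))) c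
  -- Since Re ψ ≤ 0, the values of 1 - ψ lie in Re ≥ 1, so the resolvent is bounded by 1.
  have hnorm : ∀ k, 1 ≤ ‖1 - levySymbol a lam k‖ := fun k => by
    refine le_trans ?_ (Complex.re_le_norm _)
    have := hre k
    simp only [Complex.sub_re, Complex.one_re]
    linarith
  have dG : ∀ k, HasDerivAt G (ψ' k * G k ^ 2) k := fun k => by
    have hne : 1 - levySymbol a lam k ≠ 0 := by
      intro h
      have := hnorm k
      rw [h, norm_zero] at this
      linarith
    refine (((dψ k).const_sub 1).inv hne).congr_deriv ?_
    simp only [hG]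
    field_simp
  have hmem : ∀ f ∈ Algebra.adjoin ℂ S, Function.HasTemperateGrowth f := by
    intro f hf
    refine hasTemperateGrowth_of_mem_adjoin (S := S) ?_ ?_ ?_ hf
    · rintro f (rfl | rfl | rfl)
      exacts [fun k => (dX k).differentiableAt, fun k => (dW k).differentiableAt,
        fun k => (dG k).differentiableAt]
    · rintro f (rfl | rfl | rfl)
      · have : deriv X = 1 := by ext k; exact (dX k).deriv
        rw [this]
        exact one_mem _
      · have : deriv W = (-(Complex.I * Real.pi / 2)) • W ^ 3 := by ext k; exact (dW k).deriv
        rw [this]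
        exact Subalgebra.smul_mem _ (pow_mem hWm 3) _
      · have : deriv G = ψ' * G ^ 2 := by ext k; exact (dG k).deriv
        rw [this]
        exact mul_mem hψ'm (pow_mem hGm 2)
    · rintro f (rfl | rfl | rfl)
      · exact ⟨1, 1, fun x => by simp [hX]⟩
      · exact ⟨0, (Real.sqrt a)⁻¹, fun x => by
          rw [pow_zero, mul_one]; exact norm_inv_sqrt_add_le ha x⟩
      · refine ⟨0, 1, fun x => ?_⟩
        simp only [hG, norm_inv, pow_zero, mul_one]
        exact inv_le_one_of_one_le₀ (hnorm x)
  exact ⟨hmem _ hψm, hmem _ hGm⟩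

end Symbol

/-! ### The Lévy measure -/

/-- The function `x ↦ exp (i x) - 1 - i x`. -/
noncomputable def compExp (x : ℝ) : ℂ := Complex.exp (x * Complex.I) - 1 - x * Complex.I

@[simp] theorem compExp_zero : compExp 0 = 0 := by simp [compExp]

theorem continuous_compExp : Continuous compExp := by
  unfold compExp; fun_prop

theorem norm_exp_mul_I_sub_one_le (x : ℝ) : ‖Complex.exp (x * Complex.I) - 1‖ ≤ |x| := by
  have := Real.norm_exp_I_mul_ofReal_sub_one_le (x := x)
  rwa [mul_comm, Real.norm_eq_abs] at this

/-- Taylor's formula handles |x| ≤ 1 and the triangle inequality the rest. A global quadratic bound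
makes a second moment the only condition required of a Lévy measure. -/
theorem norm_compExp_le (x : ℝ) : ‖compExp x‖ ≤ 2 * x ^ 2 := by
  rcases le_total |x| 1 with h | h
  · have h1 : ‖(x * Complex.I : ℂ)‖ = |x| := by simp
    have := Complex.norm_exp_sub_one_sub_id_le (x := x * Complex.I) (by rwa [h1])
    rw [h1, sq_abs] at this
    have h2 := sq_nonneg x
    calc _ ≤ x ^ 2 := this
      _ ≤ _ := by linarith
  · calc ‖compExp x‖ ≤ ‖Complex.exp (x * Complex.I) - 1‖ + ‖(x * Complex.I : ℂ)‖ :=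
        norm_sub_le _ _
      _ ≤ |x| + |x| := by
        refine add_le_add (norm_exp_mul_I_sub_one_le x) ?_
        simp
      _ ≤ 2 * |x| ^ 2 := by nlinarith
      _ = _ := by rw [sq_abs]

theorem re_compExp_nonpos (x : ℝ) : (compExp x).re ≤ 0 := by
  have : (compExp x).re = Real.cos x - 1 := by
    simp [compExp, Complex.exp_ofReal_mul_I_re]
  rw [this]
  linarith [Real.cos_le_one x]

section LevyMeasure

variable {a lam : ℝ}

/-- This form exhibits the density as a multiple of the second derivative of y^(-1/2) exp(-2ay). -/
theorem levyDensity_eq (ha : 0 < a) (hlam : 0 < lam) {y : ℝ} (hy : 0 < y) :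
    levyDensity a lam y = (Real.sqrt (6 * lam * Real.pi))⁻¹ * (Real.exp (-(2 * a) * y) *
      (3 / 4 * y ^ (-(5 / 2) : ℝ) + 2 * a * y ^ (-(3 / 2) : ℝ) +
        4 * a ^ 2 * y ^ (-(1 / 2) : ℝ))) := by
  have e1 : (a * y) ^ (5 / 2 : ℝ) = a ^ 2 * a ^ (1 / 2 : ℝ) * y ^ (5 / 2 : ℝ) := by
    rw [Real.mul_rpow ha.le hy.le]
    congr 1
    rw [← Real.rpow_natCast, ← Real.rpow_add ha]; norm_num
  have e2 : (a * y) ^ (3 / 2 : ℝ) = a * a ^ (1 / 2 : ℝ) * y ^ (3 / 2 : ℝ) := by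
    rw [Real.mul_rpow ha.le hy.le]
    congr 1
    nth_rewrite 2 [← Real.rpow_one a]
    rw [← Real.rpow_add ha]; norm_num
  have e3 : (a * y) ^ (1 / 2 : ℝ) = a ^ (1 / 2 : ℝ) * y ^ (1 / 2 : ℝ) := by
    rw [Real.mul_rpow ha.le hy.le]
  have e4 : a ^ (5 / 2 : ℝ) = a ^ 2 * a ^ (1 / 2 : ℝ) := by
    rw [← Real.rpow_natCast, ← Real.rpow_add ha]; norm_num
  have p1 : 0 < a ^ (1 / 2 : ℝ) := Real.rpow_pos_of_pos ha _
  have p2 : 0 < y ^ (1 / 2 : ℝ) := Real.rpow_pos_of_pos hy _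
  have p3 : 0 < y ^ (3 / 2 : ℝ) := Real.rpow_pos_of_pos hy _
  have p4 : 0 < y ^ (5 / 2 : ℝ) := Real.rpow_pos_of_pos hy _
  have p5 : 0 < Real.sqrt (6 * lam * Real.pi) := by positivity
  rw [levyDensity, e1, e2, e3, e4, Real.rpow_neg hy.le, Real.rpow_neg hy.le, Real.rpow_neg hy.le]
  rw [show -2 * a * y = -(2 * a) * y by ring]
  field_simp
  ring

theorem levyDensity_nonneg (ha : 0 < a) {y : ℝ} (hy : 0 < y) : 0 ≤ levyDensity a lam y := by
  unfold levyDensity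
  positivity

theorem measurable_levyDensity (a lam : ℝ) : Measurable (levyDensity a lam) := by
  unfold levyDensity
  fun_prop

variable {E : Type*} [NormedAddCommGroup E] [NormedSpace ℝ E]

theorem integrable_levyPi_iff (ha : 0 < a) (f : ℝ → E) :
    Integrable f (levyPi a lam) ↔
      IntegrableOn (fun y => levyDensity a lam y • f y) (Set.Ioi 0) := by
  rw [levyPi, integrable_withDensity_iff_integrable_smul' (measurable_levyDensity a lam).ennreal_ofReal
    (ae_of_all _ fun _ => ENNReal.ofReal_lt_top), IntegrableOn]
  refine integrable_congr ?_
  filter_upwards [ae_restrict_mem measurableSet_Ioi] with y hy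
  rw [ENNReal.toReal_ofReal (levyDensity_nonneg ha hy)]

theorem integral_levyPi (ha : 0 < a) (f : ℝ → E) :
    ∫ y, f y ∂(levyPi a lam) = ∫ y in Set.Ioi 0, levyDensity a lam y • f y := by
  rw [levyPi, integral_withDensity_eq_integral_toReal_smul
    (measurable_levyDensity a lam).ennreal_ofReal (ae_of_all _ fun _ => ENNReal.ofReal_lt_top)]
  refine setIntegral_congr_fun measurableSet_Ioi fun y hy => ?_
  rw [ENNReal.toReal_ofReal (levyDensity_nonneg ha hy)]

theorem integrableOn_rpow_mul_exp_neg {b s : ℝ} (hb : 0 < b) (hs : -1 < s) :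
    IntegrableOn (fun y : ℝ => y ^ s * Real.exp (-b * y)) (Set.Ioi 0) := by
  simpa using integrableOn_rpow_mul_exp_neg_mul_rpow hs one_pos hb

/-- The factor y² raises the exponents -5/2, -3/2, -1/2 to -1/2, 1/2, 3/2, all above -1, and the
exponential controls infinity. -/
theorem integrable_sq_levyPi (ha : 0 < a) (hlam : 0 < lam) :
    Integrable (fun y : ℝ => y ^ 2) (levyPi a lam) := by
  rw [integrable_levyPi_iff ha]
  have hb : 0 < 2 * a := by positivity
  have h := (((integrableOn_rpow_mul_exp_neg hb (s := -(1 / 2)) (by norm_num)).const_mul (3 / 4)).add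
    (((integrableOn_rpow_mul_exp_neg hb (s := 1 / 2) (by norm_num)).const_mul (2 * a)).add
    ((integrableOn_rpow_mul_exp_neg hb (s := 3 / 2) (by norm_num)).const_mul (4 * a ^ 2)))).const_mul
      (Real.sqrt (6 * lam * Real.pi))⁻¹
  refine (integrableOn_congr_fun (fun y hy => ?_) measurableSet_Ioi).mp h
  have hy : 0 < y := hy
  have e (s : ℝ) : y ^ (s + 2) = y ^ s * y ^ 2 := by
    rw [← Real.rpow_natCast y 2, ← Real.rpow_add hy]; norm_num
  have e1 : y ^ (-(1 / 2) : ℝ) = y ^ (-(5 / 2) : ℝ) * y ^ 2 := by rw [← e]; norm_num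
  have e2 : y ^ (1 / 2 : ℝ) = y ^ (-(3 / 2) : ℝ) * y ^ 2 := by rw [← e]; norm_num
  have e3 : y ^ (3 / 2 : ℝ) = y ^ (-(1 / 2) : ℝ) * y ^ 2 := by rw [← e]; norm_num
  simp only [Pi.add_apply]
  rw [levyDensity_eq ha hlam hy, e2, e3, smul_eq_mul]
  linear_combination ((Real.sqrt (6 * lam * Real.pi))⁻¹ * (3 / 4) * Real.exp (-(2 * a) * y)) * e1

theorem isLevyMeasure_levyPi (ha : 0 < a) (hlam : 0 < lam) : IsLevyMeasure (levyPi a lam) := by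
  constructor
  · exact withDensity_absolutelyContinuous _ _ (by simp)
  · refine lt_of_le_of_lt (lintegral_mono fun y => ?_) (integrable_sq_levyPi ha hlam).lintegral_lt_top
    exact ENNReal.ofReal_le_ofReal (min_le_right _ _)

theorem integrable_compExp_mul {Λ : Measure ℝ} (hΛ : Integrable (fun y : ℝ => y ^ 2) Λ)
    (θ : ℝ) : Integrable (fun y : ℝ => compExp (θ * y)) Λ := by
  refine (hΛ.const_mul (2 * θ ^ 2)).mono'
    (continuous_compExp.comp (by fun_prop)).aestronglyMeasurable (ae_of_all _ fun y => ?_)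
  refine (norm_compExp_le _).trans (le_of_eq (by ring))

/-- The Laplace transform of `y ↦ y ^ (-1/2)` on the right half-plane. -/
theorem integral_rpow_neg_half_mul_exp {r : ℂ} (hr : 0 < r.re) :
    ∫ y : ℝ in Set.Ioi 0, (y ^ (-(1 / 2) : ℝ) : ℝ) • Complex.exp (-r * y)
      = (Real.pi / r) ^ (1 / 2 : ℂ) := by
  -- The substitution y = x² absorbs the singularity and leaves a Gaussian integral.
  have h := integral_comp_rpow_Ioi
    (fun y : ℝ => (y ^ (-(1 / 2) : ℝ) : ℝ) • Complex.exp (-r * y)) (p := 2) two_ne_zero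
  rw [← h]
  have h2 := integral_gaussian_complex_Ioi hr
  have h3 : (Real.pi / r) ^ (1 / 2 : ℂ) = 2 * ∫ x : ℝ in Set.Ioi 0, Complex.exp (-r * x ^ 2) := by
    rw [h2]; ring
  rw [h3, ← integral_const_mul]
  refine setIntegral_congr_fun measurableSet_Ioi fun x hx => ?_
  have hx : 0 < x := hx
  rw [← Real.rpow_mul hx.le, smul_smul, mul_assoc, ← Real.rpow_add hx]
  norm_num

end LevyMeasure

/-! ### The symbol as a Lévy–Khintchine exponent -/

section LevyExponent

variable {a lam : ℝ}

theorem hasDerivAt_rpow_mul_exp (p b : ℝ) {y : ℝ} (hy : 0 < y) :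
    HasDerivAt (fun y : ℝ => y ^ p * Real.exp (-b * y))
      (p * (y ^ (p - 1) * Real.exp (-b * y)) - b * (y ^ p * Real.exp (-b * y))) y := by
  have h1 := Real.hasDerivAt_rpow_const (p := p) (Or.inl hy.ne')
  have h2 : HasDerivAt (fun y : ℝ => Real.exp (-b * y)) (Real.exp (-b * y) * -b) y := by
    simpa using ((hasDerivAt_id y).const_mul (-b)).exp
  exact (h1.mul h2).congr_deriv (by ring)

theorem hasDerivAt_exp_mul_I (θ y : ℝ) :
    HasDerivAt (fun y : ℝ => Complex.exp ((θ * y : ℝ) * Complex.I))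
      (θ * Complex.I * Complex.exp ((θ * y : ℝ) * Complex.I)) y := by
  have h1 : HasDerivAt (fun y : ℝ => (((θ * y : ℝ) : ℂ) * Complex.I)) (θ * Complex.I) y := by
    have := (((hasDerivAt_id y).const_mul θ).ofReal_comp).mul_const Complex.I
    simpa using this
  exact h1.cexp.congr_deriv (by ring)

theorem hasDerivAt_compExp_mul (θ y : ℝ) :
    HasDerivAt (fun y : ℝ => compExp (θ * y))
      (θ * Complex.I * (Complex.exp ((θ * y : ℝ) * Complex.I) - 1)) y := by
  have h1 : HasDerivAt (fun y : ℝ => (((θ * y : ℝ) : ℂ) * Complex.I)) (θ * Complex.I) y := by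
    have := (((hasDerivAt_id y).const_mul θ).ofReal_comp).mul_const Complex.I
    simpa using this
  exact (((hasDerivAt_exp_mul_I θ y).sub_const 1).sub h1).congr_deriv (by ring)

/-- Two integrations by parts for the compensated exponential against the second derivative of
`y ↦ y ^ (-1/2) * exp (-b y)`. -/
theorem integral_compExp_mul_deriv_deriv {b : ℝ} (hb : 0 < b) (θ : ℝ)
    (hint : IntegrableOn (fun y : ℝ => (Real.exp (-b * y) * (3 / 4 * y ^ (-(5 / 2) : ℝ) +
      b * y ^ (-(3 / 2) : ℝ) + b ^ 2 * y ^ (-(1 / 2) : ℝ))) • compExp (θ * y)) (Set.Ioi 0)) :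
    ∫ y in Set.Ioi 0, (Real.exp (-b * y) * (3 / 4 * y ^ (-(5 / 2) : ℝ) +
      b * y ^ (-(3 / 2) : ℝ) + b ^ 2 * y ^ (-(1 / 2) : ℝ))) • compExp (θ * y) =
    (θ * Complex.I) ^ 2 * (Real.pi / (b - θ * Complex.I)) ^ (1 / 2 : ℂ) := by
  set q : ℂ := θ * Complex.I with hq
  set h : ℝ → ℝ := fun y => y ^ (-(1 / 2) : ℝ) * Real.exp (-b * y) with hh
  set h1 : ℝ → ℝ := fun y => -(1 / 2) * (y ^ (-(3 / 2) : ℝ) * Real.exp (-b * y)) -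
    b * (y ^ (-(1 / 2) : ℝ) * Real.exp (-b * y)) with hh1
  set h2 : ℝ → ℝ := fun y => Real.exp (-b * y) * (3 / 4 * y ^ (-(5 / 2) : ℝ) +
      b * y ^ (-(3 / 2) : ℝ) + b ^ 2 * y ^ (-(1 / 2) : ℝ)) with hh2
  have dh : ∀ y ∈ Set.Ioi (0 : ℝ), HasDerivAt h (h1 y) y := fun y hy => by
    refine (hasDerivAt_rpow_mul_exp (-(1 / 2)) b hy).congr_deriv ?_
    simp only [hh1]
    norm_num
  have dh1 : ∀ y ∈ Set.Ioi (0 : ℝ), HasDerivAt h1 (h2 y) y := fun y hy => by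
    refine (((hasDerivAt_rpow_mul_exp (-(3 / 2)) b hy).const_mul (-(1 / 2))).sub
      ((hasDerivAt_rpow_mul_exp (-(1 / 2)) b hy).const_mul b)).congr_deriv ?_
    simp only [hh2]
    norm_num
    ring
  -- F collects the boundary terms of both integrations by parts at once: its derivative is the
  -- difference of the two integrands.
  set F : ℝ → ℂ := fun y => (h1 y : ℂ) * compExp (θ * y) -
    (h y : ℂ) * (q * (Complex.exp ((θ * y : ℝ) * Complex.I) - 1)) with hF
  have dF : ∀ y ∈ Set.Ioi (0 : ℝ), HasDerivAt F (h2 y • compExp (θ * y) -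
      q ^ 2 * (h y • Complex.exp ((θ * y : ℝ) * Complex.I))) y := fun y hy => by
    refine (((dh1 y hy).ofReal_comp.mul (hasDerivAt_compExp_mul θ y)).sub
      ((dh y hy).ofReal_comp.mul (((hasDerivAt_exp_mul_I θ y).sub_const 1).const_mul q))).congr_deriv ?_
    simp only [Complex.real_smul, hq]
    ring
  have hE : IntegrableOn (fun y => h y • Complex.exp ((θ * y : ℝ) * Complex.I)) (Set.Ioi 0) := by
    have := integrableOn_rpow_mul_exp_neg hb (s := -(1 / 2)) (by norm_num)
    refine Integrable.mono' this ?_ ?_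
    · exact this.aestronglyMeasurable.smul (Continuous.aestronglyMeasurable (by fun_prop))
    · filter_upwards [ae_restrict_mem measurableSet_Ioi] with y hy
      have hy : 0 < y := hy
      rw [norm_smul, Complex.norm_exp_ofReal_mul_I, mul_one, Real.norm_of_nonneg (by simp only [hh]; positivity)]
  -- The singularity y^(-3/2) of h' meets a factor of order y², and y^(-1/2) meets one of order y.
  -- The resulting majorant B therefore vanishes both at 0 and at infinity.
  set B : ℝ → ℝ := fun y => (2 * θ ^ 2) * ((1 / 2) * (y ^ (1 / 2 : ℝ) * Real.exp (-b * y)) +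
    b * (y ^ (3 / 2 : ℝ) * Real.exp (-b * y))) + θ ^ 2 * (y ^ (1 / 2 : ℝ) * Real.exp (-b * y)) with hB
  have hFB : ∀ y ∈ Set.Ici (0 : ℝ), ‖F y‖ ≤ B y := fun y hy => by
    rcases (show 0 ≤ y from hy).eq_or_lt with rfl | hy
    · simp [hF, hB]
    have e1 : y ^ (1 / 2 : ℝ) = y ^ (-(3 / 2) : ℝ) * y ^ 2 := by
      rw [← Real.rpow_natCast y 2, ← Real.rpow_add hy]; norm_num
    have e2 : y ^ (3 / 2 : ℝ) = y ^ (-(1 / 2) : ℝ) * y ^ 2 := by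
      rw [← Real.rpow_natCast y 2, ← Real.rpow_add hy]; norm_num
    have e3 : y ^ (1 / 2 : ℝ) = y ^ (-(1 / 2) : ℝ) * y := by
      nth_rewrite 3 [← Real.rpow_one y]
      rw [← Real.rpow_add hy]; norm_num
    have n1 : |h1 y| = 1 / 2 * (y ^ (-(3 / 2) : ℝ) * Real.exp (-b * y)) +
        b * (y ^ (-(1 / 2) : ℝ) * Real.exp (-b * y)) := by
      have p : 0 ≤ 1 / 2 * (y ^ (-(3 / 2) : ℝ) * Real.exp (-b * y)) +
        b * (y ^ (-(1 / 2) : ℝ) * Real.exp (-b * y)) := by positivity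
      rw [← abs_of_nonneg p, ← abs_neg]
      congr 1
      simp only [hh1]; ring
    have n2 : |h y| = y ^ (-(1 / 2) : ℝ) * Real.exp (-b * y) := abs_of_nonneg (by positivity)
    have nq : ‖q‖ = |θ| := by simp [hq]
    calc ‖F y‖ ≤ ‖(h1 y : ℂ) * compExp (θ * y)‖ +
          ‖(h y : ℂ) * (q * (Complex.exp ((θ * y : ℝ) * Complex.I) - 1))‖ := norm_sub_le _ _
      _ ≤ |h1 y| * (2 * (θ * y) ^ 2) + |h y| * (|θ| * |θ * y|) := by
        rw [norm_mul, norm_mul, norm_mul, Complex.norm_real, Complex.norm_real, nq]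
        gcongr
        · exact le_rfl
        · exact norm_compExp_le _
        · exact le_rfl
        · exact norm_exp_mul_I_sub_one_le _
      _ = B y := by
        rw [n1, n2, abs_mul, abs_of_pos hy]
        have : |θ| * (|θ| * y) = θ ^ 2 * y := by rw [← mul_assoc, ← sq, sq_abs]
        rw [this]
        simp only [hB]
        rw [e2]
        linear_combination (-(θ ^ 2) * Real.exp (-b * y)) * e1 - θ ^ 2 * Real.exp (-b * y) * e3
  have hB0 : B 0 = 0 := by simp [hB]
  have hF0 : F 0 = 0 := by simp [hF]
  have hBc : Continuous B := by
    have c1 : Continuous fun y : ℝ => y ^ (1 / 2 : ℝ) := Real.continuous_rpow_const (by norm_num)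
    have c2 : Continuous fun y : ℝ => y ^ (3 / 2 : ℝ) := Real.continuous_rpow_const (by norm_num)
    simp only [hB]
    fun_prop
  have hcont : ContinuousWithinAt F (Set.Ici 0) 0 := by
    rw [ContinuousWithinAt, hF0]
    refine squeeze_zero_norm' (a := B) (eventually_mem_nhdsWithin.mono hFB) ?_
    have := hBc.tendsto 0
    rw [hB0] at this
    exact this.mono_left nhdsWithin_le_nhds
  have hlim : Tendsto F atTop (𝓝 0) := by
    refine squeeze_zero_norm' (a := B) ((eventually_ge_atTop 0).mono hFB) ?_
    have t1 := tendsto_rpow_mul_exp_neg_mul_atTop_nhds_zero (1 / 2) b hb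
    have t2 := tendsto_rpow_mul_exp_neg_mul_atTop_nhds_zero (3 / 2) b hb
    have := (((t1.const_mul (1 / 2)).add (t2.const_mul b)).const_mul (2 * θ ^ 2)).add
      (t1.const_mul (θ ^ 2))
    simpa only [mul_zero, add_zero] using this
  have key := integral_Ioi_of_hasDerivAt_of_tendsto hcont dF (hint.sub (hE.const_mul (q ^ 2))) hlim
  rw [hF0, sub_zero, integral_sub hint (hE.const_mul (q ^ 2)), integral_const_mul, sub_eq_zero] at key
  rw [key]
  congr 1
  have hr : 0 < (b - q : ℂ).re := by simpa [hq] using hb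
  rw [← integral_rpow_neg_half_mul_exp hr]
  refine setIntegral_congr_fun measurableSet_Ioi fun y hy => ?_
  simp only [hh, Complex.real_smul]
  push_cast
  rw [mul_assoc, ← Complex.exp_add]
  congr 2
  simp only [hq]
  ring

/-- The symbol is the Lévy–Khintchine exponent of the Lévy measure. -/
theorem levySymbol_eq_integral (ha : 0 < a) (hlam : 0 < lam) (k : ℝ) :
    levySymbol a lam k = ∫ y, compExp (-(2 * Real.pi * k) * y) ∂(levyPi a lam) := by
  set θ : ℝ := -(2 * Real.pi * k) with hθ
  set K : ℝ := (Real.sqrt (6 * lam * Real.pi))⁻¹ with hK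
  have hKpos : 0 < K := by positivity
  have hb : 0 < 2 * a := by positivity
  have hd : ∀ y ∈ Set.Ioi (0 : ℝ), levyDensity a lam y • compExp (θ * y) =
      K • ((Real.exp (-(2 * a) * y) * (3 / 4 * y ^ (-(5 / 2) : ℝ) +
        (2 * a) * y ^ (-(3 / 2) : ℝ) + (2 * a) ^ 2 * y ^ (-(1 / 2) : ℝ))) • compExp (θ * y)) := by
    intro y hy
    rw [levyDensity_eq ha hlam hy, smul_smul]
    congr 1
    ring
  have hint := (integrable_levyPi_iff ha _).mp (integrable_compExp_mul (integrable_sq_levyPi ha hlam) θ)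
  have hint2 := (integrableOn_congr_fun hd measurableSet_Ioi).mp hint
  have hint3 := (integrable_smul_iff hKpos.ne' _).mp hint2
  rw [integral_levyPi ha, setIntegral_congr_fun measurableSet_Ioi hd, integral_smul,
    integral_compExp_mul_deriv_deriv hb θ hint3, levySymbol]
  set z : ℂ := a + Complex.I * Real.pi * k with hz
  have hzs := add_I_pi_mul_mem_slitPlane ha k
  have hz0 : z ≠ 0 := Complex.slitPlane_ne_zero hzs
  have e1 : (Real.pi / ((2 * a : ℝ) - θ * Complex.I) : ℂ) = ((Real.pi / 2 : ℝ) : ℂ) * z⁻¹ := by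
    have : ((2 * a : ℝ) - θ * Complex.I : ℂ) = 2 * z := by
      simp only [hθ, hz]; push_cast; ring
    rw [this]
    push_cast
    field_simp
  -- The principal root splits because one factor is positive and z lies in the slit plane, where
  -- log z⁻¹ = -log z.
  have e2 : (Real.pi / ((2 * a : ℝ) - θ * Complex.I) : ℂ) ^ (1 / 2 : ℂ)
      = (Real.sqrt (Real.pi / 2) : ℂ) * (Complex.sqrt z)⁻¹ := by
    have p : 0 < Real.pi / 2 := by positivity
    rw [e1, Complex.cpow_def_of_ne_zero (mul_ne_zero (by exact_mod_cast p.ne') (inv_ne_zero hz0)),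
      Complex.log_ofReal_mul p (inv_ne_zero hz0), Complex.log_inv _ (Complex.slitPlane_arg_ne_pi hzs),
      Complex.sqrt, Complex.cpow_def_of_ne_zero hz0, ← Complex.exp_neg, Real.sqrt_eq_rpow,
      Real.rpow_def_of_pos p, Complex.ofReal_exp, ← Complex.exp_add]
    congr 1
    push_cast
    ring
  rw [e2]
  have e3 : K * Real.sqrt (Real.pi / 2) = 1 / (2 * Real.sqrt (3 * lam)) := by
    rw [hK, ← Real.sqrt_inv, ← Real.sqrt_mul (by positivity)]
    have : (6 * lam * Real.pi)⁻¹ * (Real.pi / 2) = (1 / (2 * Real.sqrt (3 * lam))) ^ 2 := by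
      rw [div_pow, mul_pow, Real.sq_sqrt (by positivity)]
      field_simp
      norm_num
    rw [this, Real.sqrt_sq (by positivity)]
  have e4 : (K : ℂ) * (Real.sqrt (Real.pi / 2) : ℂ) = 1 / (2 * (Real.sqrt (3 * lam) : ℂ)) := by
    exact_mod_cast congrArg (fun x : ℝ => (x : ℂ)) e3
  rw [← e4, Complex.real_smul]
  simp only [hθ]
  push_cast
  ring

theorem re_levySymbol_nonpos (ha : 0 < a) (hlam : 0 < lam) (k : ℝ) :
    (levySymbol a lam k).re ≤ 0 := by
  rw [levySymbol_eq_integral ha hlam]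
  have h := integral_re (integrable_compExp_mul (integrable_sq_levyPi ha hlam) (-(2 * Real.pi * k)))
  simp only [RCLike.re_to_complex] at h
  rw [← h]
  exact integral_nonpos fun y => re_compExp_nonpos _

end LevyExponent

/-! ### Fourier inversion and multipliers on the Schwartz space -/

section SchwartzMultiplier

theorem SchwartzMap.eq_integral_fourier (φ : 𝓢(ℝ, ℂ)) (u : ℝ) :
    φ u = ∫ k : ℝ, Complex.exp ((2 * Real.pi * k * u : ℝ) * Complex.I) * 𝓕 (φ : ℝ → ℂ) k := by
  have h : (𝓕⁻ (𝓕 φ) : 𝓢(ℝ, ℂ)) u = φ u := by simp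
  rw [← h, SchwartzMap.fourierInv_coe, Real.fourierInv_eq']
  refine integral_congr_ae (ae_of_all _ fun k => ?_)
  simp only [SchwartzMap.fourier_coe, smul_eq_mul, RCLike.inner_apply, conj_trivial]
  congr 3
  push_cast
  ring

theorem SchwartzMap.fourier_fourierMultiplierCLM {g : ℝ → ℂ} (hg : g.HasTemperateGrowth)
    (φ : 𝓢(ℝ, ℂ)) (k : ℝ) :
    𝓕 (SchwartzMap.fourierMultiplierCLM ℂ g φ : ℝ → ℂ) k = g k * 𝓕 (φ : ℝ → ℂ) k := by
  rw [← SchwartzMap.fourier_coe, SchwartzMap.fourierMultiplierCLM_apply,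
    FourierTransform.fourier_fourierInv_eq, SchwartzMap.smulLeftCLM_apply_apply hg,
    SchwartzMap.fourier_coe, smul_eq_mul]

theorem SchwartzMap.fourierMultiplierCLM_coe {g : ℝ → ℂ} (hg : g.HasTemperateGrowth)
    (φ : 𝓢(ℝ, ℂ)) :
    (SchwartzMap.fourierMultiplierCLM ℂ g φ : ℝ → ℂ) = 𝓕⁻ fun k => g k * 𝓕 (φ : ℝ → ℂ) k := by
  rw [SchwartzMap.fourierMultiplierCLM_apply, SchwartzMap.fourierInv_coe]
  congr 1
  ext k
  rw [SchwartzMap.smulLeftCLM_apply_apply hg, SchwartzMap.fourier_coe, smul_eq_mul]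

theorem SchwartzMap.fourier_deriv (φ : 𝓢(ℝ, ℂ)) (k : ℝ) :
    𝓕 (SchwartzMap.derivCLM ℂ ℂ φ : ℝ → ℂ) k
      = (2 * Real.pi * Complex.I * k) * 𝓕 (φ : ℝ → ℂ) k := by
  have h := Real.fourier_deriv φ.integrable φ.differentiable
    (SchwartzMap.derivCLM ℂ ℂ φ).integrable
  exact congrFun h k

theorem SchwartzMap.integrable_fourier (φ : 𝓢(ℝ, ℂ)) : Integrable (𝓕 (φ : ℝ → ℂ)) :=
  (𝓕 φ).integrable

theorem SchwartzMap.continuous_fourier (φ : 𝓢(ℝ, ℂ)) : Continuous (𝓕 (φ : ℝ → ℂ)) :=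
  (𝓕 φ).continuous

theorem integrable_exp_mul {f : ℝ → ℂ} (hf : Integrable f) {c : ℝ → ℝ} (hc : Continuous c) :
    Integrable fun k : ℝ => Complex.exp ((c k : ℂ) * Complex.I) * f k := by
  refine hf.bdd_mul (c := 1) (Continuous.aestronglyMeasurable (by fun_prop)) ?_
  exact ae_of_all _ fun k => (Complex.norm_exp_ofReal_mul_I _).le

/-- Fourier representation of the compensated increments of a Schwartz function. -/
theorem SchwartzMap.sub_sub_add_eq_integral (φ : 𝓢(ℝ, ℂ)) (u y : ℝ) :
    φ (u - y) - φ u + (y : ℂ) * deriv (φ : ℝ → ℂ) u =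
      ∫ k : ℝ, Complex.exp ((2 * Real.pi * k * u : ℝ) * Complex.I) *
        (compExp (-(2 * Real.pi * k) * y) * 𝓕 (φ : ℝ → ℂ) k) := by
  have hd : deriv (φ : ℝ → ℂ) u = SchwartzMap.derivCLM ℂ ℂ φ u := rfl
  have i1 := integrable_exp_mul φ.integrable_fourier (c := fun k => 2 * Real.pi * k * (u - y))
    (by fun_prop)
  have i2 := integrable_exp_mul φ.integrable_fourier (c := fun k => 2 * Real.pi * k * u)
    (by fun_prop)
  have i3 := integrable_exp_mul (SchwartzMap.derivCLM ℂ ℂ φ).integrable_fourier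
    (c := fun k => 2 * Real.pi * k * u) (by fun_prop)
  rw [hd, φ.eq_integral_fourier (u - y), φ.eq_integral_fourier u,
    (SchwartzMap.derivCLM ℂ ℂ φ).eq_integral_fourier u, ← integral_sub i1 i2, ← integral_const_mul]
  refine (integral_add (i1.sub i2) (i3.const_mul _)).symm.trans ?_
  refine integral_congr_ae (ae_of_all _ fun k => ?_)
  have e : Complex.exp ((2 * Real.pi * k * (u - y) : ℝ) * Complex.I) =
      Complex.exp ((2 * Real.pi * k * u : ℝ) * Complex.I) *
        Complex.exp ((-(2 * Real.pi * k) * y : ℝ) * Complex.I) := by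
    rw [← Complex.exp_add]
    congr 1
    push_cast
    ring
  simp only [SchwartzMap.fourier_deriv, compExp, e, Pi.sub_apply]
  push_cast
  ring

end SchwartzMultiplier

/-! ### The operator on Schwartz functions and its integral representation -/

section LevyKhintchine

variable {a lam : ℝ}

theorem hasTemperateGrowth_levySymbol (ha : 0 < a) (hlam : 0 < lam) :
    Function.HasTemperateGrowth (levySymbol a lam) :=
  (hasTemperateGrowth_levySymbol_and_resolvent ha (re_levySymbol_nonpos ha hlam)).1

/-- The operator `levyOp` as a map of the Schwartz space into itself. -/
noncomputable def levyOpSchwartz (a lam : ℝ) (φ : 𝓢(ℝ, ℂ)) : 𝓢(ℝ, ℂ) :=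
  SchwartzMap.fourierMultiplierCLM ℂ (levySymbol a lam) φ

theorem levyOpSchwartz_coe (ha : 0 < a) (hlam : 0 < lam) (φ : 𝓢(ℝ, ℂ)) :
    (levyOpSchwartz a lam φ : ℝ → ℂ) = levyOp a lam φ :=
  SchwartzMap.fourierMultiplierCLM_coe (hasTemperateGrowth_levySymbol ha hlam) φ

theorem fourier_levyOpSchwartz (ha : 0 < a) (hlam : 0 < lam) (φ : 𝓢(ℝ, ℂ)) (k : ℝ) :
    𝓕 (levyOpSchwartz a lam φ : ℝ → ℂ) k = levySymbol a lam k * 𝓕 (φ : ℝ → ℂ) k :=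
  SchwartzMap.fourier_fourierMultiplierCLM (hasTemperateGrowth_levySymbol ha hlam) φ k

theorem sFinite_levyPi (a lam : ℝ) : SFinite (levyPi a lam) := by
  unfold levyPi; infer_instance

/-- The quadratic bound separates the variables: y² is integrable for Π_a and k² |𝓕 φ| for Lebesgue
measure. -/
theorem integrable_prod_compExp_mul_fourier (ha : 0 < a) (hlam : 0 < lam) (φ : 𝓢(ℝ, ℂ)) (u : ℝ) :
    Integrable (Function.uncurry fun (y k : ℝ) =>
      Complex.exp ((2 * Real.pi * k * u : ℝ) * Complex.I) *
        (compExp (-(2 * Real.pi * k) * y) * 𝓕 (φ : ℝ → ℂ) k)) ((levyPi a lam).prod volume) := by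
  have := sFinite_levyPi a lam
  have h1 : Integrable fun k : ℝ => ‖k‖ ^ 2 * ‖𝓕 (φ : ℝ → ℂ) k‖ :=
    (𝓕 φ).integrable_pow_mul volume 2
  have h2 := ((integrable_sq_levyPi ha hlam).mul_prod h1).const_mul (8 * Real.pi ^ 2)
  refine h2.mono' (Continuous.aestronglyMeasurable ?_) (ae_of_all _ fun p => ?_)
  · have c1 := φ.continuous_fourier
    have c2 := continuous_compExp
    simp only [Function.uncurry_def]
    fun_prop
  · simp only [Function.uncurry_def, norm_mul, Complex.norm_exp_ofReal_mul_I, one_mul]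
    calc _ ≤ (2 * (-(2 * Real.pi * p.2) * p.1) ^ 2) * ‖𝓕 (φ : ℝ → ℂ) p.2‖ := by
          gcongr
          exact norm_compExp_le _
      _ = _ := by
          rw [Real.norm_eq_abs, sq_abs]
          ring

/-- The Lévy–Khintchine representation. -/
theorem levyOp_eq_integral (ha : 0 < a) (hlam : 0 < lam) (φ : 𝓢(ℝ, ℂ)) (u : ℝ) :
    Integrable (fun y : ℝ => φ (u - y) - φ u + (y : ℂ) * deriv (φ : ℝ → ℂ) u) (levyPi a lam) ∧
      levyOp a lam φ u =
        ∫ y : ℝ, (φ (u - y) - φ u + (y : ℂ) * deriv (φ : ℝ → ℂ) u) ∂(levyPi a lam) := by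
  have := sFinite_levyPi a lam
  have hint := integrable_prod_compExp_mul_fourier ha hlam φ u
  simp only [SchwartzMap.sub_sub_add_eq_integral]
  refine ⟨hint.integral_prod_left, ?_⟩
  rw [integral_integral_swap hint, ← levyOpSchwartz_coe ha hlam, SchwartzMap.eq_integral_fourier]
  refine integral_congr_ae (ae_of_all _ fun k => ?_)
  simp only
  rw [integral_const_mul, integral_mul_const, ← levySymbol_eq_integral ha hlam,
    fourier_levyOpSchwartz ha hlam]

theorem levyOp_im_eq_zero (ha : 0 < a) (hlam : 0 < lam) (φ : 𝓢(ℝ, ℂ)) (hφ : ∀ u, (φ u).im = 0)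
    (u : ℝ) : (levyOp a lam φ u).im = 0 := by
  obtain ⟨h1, h2⟩ := levyOp_eq_integral ha hlam φ u
  have hd : (deriv (φ : ℝ → ℂ) u).im = 0 := by
    have h3 := Complex.imCLM.hasFDerivAt.comp_hasDerivAt u (φ.differentiableAt (x := u)).hasDerivAt
    have h4 : (Complex.imCLM ∘ (φ : ℝ → ℂ)) = fun _ => (0 : ℝ) := funext fun x => hφ x
    rw [h4] at h3
    exact h3.unique (hasDerivAt_const u (0 : ℝ))
  have h5 := integral_im h1
  simp only [RCLike.im_to_complex] at h5
  rw [h2, ← h5]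
  simp [hφ, hd]

end LevyKhintchine

/-! ### Characteristic functions of infinitely divisible laws -/

section CharFun

variable {E : Type*} [NormedAddCommGroup E] [InnerProductSpace ℝ E] [MeasurableSpace E]

/-- A function which is the characteristic function of a probability measure. -/
def IsCharFun (f : E → ℂ) : Prop :=
  ∃ μ : Measure E, IsProbabilityMeasure μ ∧ ∀ t, charFun μ t = f t

variable [BorelSpace E] [FiniteDimensional ℝ E]

/-- Lévy's continuity theorem: continuity of the limit at 0 forces tightness, and any cluster point
of the laws has the limit as its characteristic function. -/
theorem IsCharFun.of_tendsto {f : E → ℂ} {g : ℕ → E → ℂ} (hg : ∀ n, IsCharFun (g n))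
    (hf : ContinuousAt f 0) (h : ∀ t, Tendsto (fun n => g n t) atTop (𝓝 (f t))) :
    IsCharFun f := by
  choose μ hμ hμg using hg
  have htight : IsTightMeasureSet (Set.range μ) :=
    isTightMeasureSet_of_tendsto_charFun hf fun t => by simpa only [hμg] using h t
  let ν : ℕ → ProbabilityMeasure E := fun n => ⟨μ n, hμ n⟩
  have hcomp : IsCompact (closure (Set.range ν)) := by
    refine isCompact_closure_of_isTightMeasureSet (htight.subset ?_)
    rintro _ ⟨_, ⟨n, rfl⟩, rfl⟩
    exact ⟨n, rfl⟩
  obtain ⟨ρ, -, hρ⟩ := hcomp.exists_mapClusterPt (f := atTop) (u := ν)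
    (tendsto_principal.mpr (.of_forall fun n => subset_closure (Set.mem_range_self n)))
  obtain ⟨U, hU, hUρ⟩ := mapClusterPt_iff_ultrafilter.mp hρ
  refine ⟨ρ, inferInstance, fun t => ?_⟩
  rw [ProbabilityMeasure.tendsto_iff_forall_integral_rclike_tendsto ℂ] at hUρ
  have h1 := hUρ (BoundedContinuousFunction.innerProbChar t)
  simp only [← charFun_eq_integral_innerProbChar] at h1
  have h2 : Tendsto (fun n => charFun (ν n : Measure E) t) U (𝓝 (f t)) := by
    have h3 : (fun n => charFun (ν n : Measure E) t) = fun n => g n t := funext fun n => hμg n t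
    rw [h3]
    exact (h t).mono_left hU
  exact tendsto_nhds_unique h1 h2

omit [FiniteDimensional ℝ E] in
theorem isCharFun_one : IsCharFun (fun _ : E => (1 : ℂ)) :=
  ⟨Measure.dirac 0, inferInstance, fun t => by simp [charFun_dirac]⟩

omit [FiniteDimensional ℝ E] in
theorem isCharFun_exp_inner (x : E) :
    IsCharFun (fun t : E => Complex.exp ((inner ℝ x t : ℝ) * Complex.I)) :=
  ⟨Measure.dirac x, inferInstance, fun t => by simp [charFun_dirac]⟩

theorem IsCharFun.mul {f g : E → ℂ} (hf : IsCharFun f) (hg : IsCharFun g) :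
    IsCharFun (fun t => f t * g t) := by
  obtain ⟨μ, hμ, hμf⟩ := hf
  obtain ⟨ν, hν, hνg⟩ := hg
  exact ⟨μ.conv ν, inferInstance, fun t => by rw [charFun_conv, hμf, hνg]⟩

theorem IsCharFun.pow {f : E → ℂ} (hf : IsCharFun f) (n : ℕ) : IsCharFun (fun t => f t ^ n) := by
  induction n with
  | zero => simpa using isCharFun_one
  | succ n ih => simpa only [pow_succ] using ih.mul hf

/-- Compound Poisson laws. -/
theorem isCharFun_compoundPoisson (ν : Measure E) [IsFiniteMeasure ν] :
    IsCharFun (fun t => Complex.exp (charFun ν t - ν.real Set.univ)) := by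
  set θ : ℝ := ν.real Set.univ with hθ
  obtain ⟨N, hN⟩ := exists_nat_gt θ
  have hθ0 : 0 ≤ θ := measureReal_nonneg
  have hN0 : (0 : ℝ) < N := hθ0.trans_lt hN
  -- Each base is the characteristic function of (1 - θ/m) δ₀ + ν/m with m = n + N; the shift by N >
  -- θ keeps the weight of δ₀ nonnegative.
  refine IsCharFun.of_tendsto (g := fun n t => (1 + (charFun ν t - θ) / ((n + N : ℕ) : ℂ)) ^ (n + N))
    (fun n => IsCharFun.pow ?_ _) ?_ fun t => ?_
  · set r : ℝ := ((n + N : ℕ) : ℝ)⁻¹ with hr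
    have hpos : (0 : ℝ) < ((n + N : ℕ) : ℝ) := by push_cast; positivity
    have hr0 : 0 ≤ r := by positivity
    have hrθ : 0 ≤ 1 - θ * r := by
      rw [hr, ← div_eq_mul_inv, sub_nonneg, div_le_one hpos]
      push_cast
      linarith [(Nat.cast_nonneg n : (0 : ℝ) ≤ n)]
    refine ⟨ENNReal.ofReal (1 - θ * r) • Measure.dirac 0 + ENNReal.ofReal r • ν, ⟨?_⟩, fun t => ?_⟩
    · simp only [Measure.add_apply, Measure.smul_apply, measure_univ, smul_eq_mul, mul_one]
      rw [← ofReal_measureReal (μ := ν), ← ENNReal.ofReal_mul hr0,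
        ← ENNReal.ofReal_add hrθ (by positivity), ← hθ]
      simp [mul_comm]
    · have hb (ρ : Measure E) [IsFiniteMeasure ρ] :
          Integrable (fun x : E => Complex.exp ((inner ℝ x t : ℝ) * Complex.I)) ρ := by
        refine Integrable.of_bound (C := 1) (Continuous.aestronglyMeasurable (by fun_prop)) ?_
        exact ae_of_all _ fun x => (Complex.norm_exp_ofReal_mul_I _).le
      rw [charFun_apply, integral_add_measure ((hb _).smul_measure ENNReal.ofReal_ne_top)
        ((hb _).smul_measure ENNReal.ofReal_ne_top), integral_smul_measure, integral_smul_measure,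
        ENNReal.toReal_ofReal hrθ, ENNReal.toReal_ofReal hr0, ← charFun_apply, ← charFun_apply,
        charFun_dirac]
      simp only [inner_zero_left, Complex.ofReal_zero, zero_mul, Complex.exp_zero,
        Complex.real_smul, hr]
      push_cast
      ring
  · exact (Complex.continuous_exp.comp (continuous_charFun.sub continuous_const)).continuousAt
  · exact (Complex.tendsto_one_add_div_pow_exp (charFun ν t - θ)).comp (tendsto_add_atTop_nat N)

variable {S : Type*} [MeasurableSpace S]

/-- Compensated Poisson integrals: the characteristic function attached to a square integrable
jump function `f` on a measure space `(S, m)`. -/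
theorem isCharFun_exp_integral_compExp (m : Measure S) {f : S → E} (hf : Measurable f)
    (hf2 : Integrable (fun s => ‖f s‖ ^ 2) m) :
    IsCharFun (fun t => Complex.exp (∫ s, compExp (inner ℝ (f s) t) ∂m)) := by
  have hbound : ∀ t s, ‖compExp (inner ℝ (f s) t)‖ ≤ 2 * ‖t‖ ^ 2 * ‖f s‖ ^ 2 := fun t s => by
    refine (norm_compExp_le _).trans ?_
    have h := abs_real_inner_le_norm (f s) t
    have h' : (inner ℝ (f s) t) ^ 2 ≤ (‖f s‖ * ‖t‖) ^ 2 := sq_le_sq' (by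
      have := neg_abs_le (inner ℝ (f s) t : ℝ); linarith) ((le_abs_self _).trans h)
    nlinarith
  have hmeas : ∀ t, Measurable fun s => compExp (inner ℝ (f s) t) := fun t =>
    continuous_compExp.measurable.comp (hf.inner_const)
  -- Square integrability gives these sets finite measure, so the jumps kept there form a compound
  -- Poisson law; they exhaust {f ≠ 0}.
  set A : ℕ → Set S := fun n => {s | 1 / ((n : ℝ) + 1) ≤ ‖f s‖} with hA
  have hAm : ∀ n, MeasurableSet (A n) := fun n => measurableSet_le measurable_const hf.norm
  refine IsCharFun.of_tendsto
    (g := fun n t => Complex.exp (∫ s in A n, compExp (inner ℝ (f s) t) ∂m))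
    (fun n => ?_) ?_ fun t => ?_
  · have hpos : (0 : ℝ) < 1 / ((n : ℝ) + 1) := by positivity
    have hfin : m (A n) < ∞ := by
      have h1 : m {s | (1 / ((n : ℝ) + 1)) ^ 2 ≤ ‖f s‖ ^ 2} < ∞ := by
        have := hf2.measure_norm_ge_lt_top (ε := (1 / ((n : ℝ) + 1)) ^ 2) (by positivity)
        simpa using this
      refine lt_of_le_of_lt (measure_mono fun s hs => ?_) h1
      exact pow_le_pow_left₀ hpos.le hs 2
    have : IsFiniteMeasure (m.restrict (A n)) := ⟨by simpa using hfin⟩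
    have hfi : Integrable f (m.restrict (A n)) := by
      refine ((hf2.restrict (s := A n)).const_mul ((n : ℝ) + 1)).mono' hf.aestronglyMeasurable ?_
      filter_upwards [ae_restrict_mem (hAm n)] with s hs
      have hs : 1 / ((n : ℝ) + 1) ≤ ‖f s‖ := hs
      rw [div_le_iff₀ (by positivity)] at hs
      nlinarith [norm_nonneg (f s)]
    -- The Dirac factor supplies the compensator, a deterministic drift.
    have hdec := (isCharFun_compoundPoisson ((m.restrict (A n)).map f)).mul
      (isCharFun_exp_inner (-∫ s in A n, f s ∂m))
    convert hdec using 2 with t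
    rw [← Complex.exp_add]
    congr 1
    have i1 : Integrable (fun s => Complex.exp ((inner ℝ (f s) t : ℝ) * Complex.I))
        (m.restrict (A n)) := by
      refine Integrable.of_bound (C := 1) ?_ ?_
      · have := hf.inner_const (𝕜 := ℝ) (c := t)
        exact Measurable.aestronglyMeasurable (by fun_prop)
      · exact ae_of_all _ fun x => (Complex.norm_exp_ofReal_mul_I _).le
    have i2 : Integrable (fun s => ((inner ℝ (f s) t : ℝ) : ℂ) * Complex.I) (m.restrict (A n)) :=
      ((hfi.inner_const t).ofReal).mul_const _
    have i12 : Integrable (fun s => Complex.exp ((inner ℝ (f s) t : ℝ) * Complex.I) - 1)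
        (m.restrict (A n)) := i1.sub (integrable_const 1)
    unfold compExp
    rw [integral_sub i12 i2, integral_sub i1 (integrable_const 1),
      integral_mul_const, integral_complex_ofReal, charFun_apply,
      integral_map hf.aemeasurable (Continuous.aestronglyMeasurable (by fun_prop)),
      map_measureReal_apply hf .univ, inner_neg_left]
    have h3 : ∫ s in A n, inner ℝ (f s) t ∂m = inner ℝ (∫ s in A n, f s ∂m) t := by
      simp_rw [real_inner_comm t]
      exact integral_inner hfi t
    rw [h3]
    simp
    ring
  · have h0 : ∫ s, compExp (inner ℝ (f s) (0 : E)) ∂m = 0 := by simp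
    refine Complex.continuous_exp.continuousAt.comp ?_
    rw [ContinuousAt, h0]
    refine squeeze_zero_norm (a := fun t : E => ∫ s, 2 * ‖t‖ ^ 2 * ‖f s‖ ^ 2 ∂m) (fun t => ?_) ?_
    · exact norm_integral_le_of_norm_le (hf2.const_mul _) (ae_of_all _ (hbound t))
    · simp only [integral_const_mul]
      have : Continuous fun t : E => 2 * ‖t‖ ^ 2 * ∫ s, ‖f s‖ ^ 2 ∂m := by fun_prop
      simpa using this.tendsto 0
  · refine (Complex.continuous_exp.tendsto _).comp ?_
    simp_rw [← integral_indicator (hAm _)]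
    refine tendsto_integral_of_dominated_convergence (fun s => 2 * ‖t‖ ^ 2 * ‖f s‖ ^ 2)
      (fun n => ((hmeas t).indicator (hAm n)).aestronglyMeasurable) (hf2.const_mul _)
      (fun n => ae_of_all _ fun s => ?_) (ae_of_all _ fun s => ?_)
    · exact (norm_indicator_le_norm_self _ _).trans (hbound t s)
    · by_cases hs : f s = 0
      · have : ∀ n, (A n).indicator (fun s => compExp (inner ℝ (f s) t)) s = 0 := fun n => by
          simp [Set.indicator, hs]
        simp [this, hs]
      · refine tendsto_const_nhds.congr' ?_
        obtain ⟨n, hn⟩ := exists_nat_one_div_lt (norm_pos_iff.mpr hs)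
        filter_upwards [eventually_ge_atTop n] with k hk
        rw [Set.indicator_of_mem]
        refine le_trans ?_ hn.le
        gcongr

end CharFun

/-! ### The Kolmogorov extension theorem -/

section Kolmogorov

variable {ι : Type*} {X : ι → Type*} [∀ i, TopologicalSpace (X i)]

/-- A sequence of closed compact cylinders with nonempty finite intersections has nonempty
intersection. -/
theorem nonempty_iInter_cylinder_of_isCompact [∀ i, T2Space (X i)] (I : ℕ → Finset ι)
    (K : ∀ n, Set (∀ i : I n, X i)) (hK : ∀ n, IsCompact (K n))
    (h : ∀ n, (⋂ k ≤ n, cylinder (I k) (K k)).Nonempty) : (⋂ k, cylinder (I k) (K k)).Nonempty := by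
  classical
  obtain ⟨x₀, -⟩ := h 0
  -- Each coordinate is confined to a compact set, the projection of the first K whose index set
  -- contains it, so that Tychonoff's theorem applies.
  let B : ∀ i, Set (X i) := fun i =>
    if hi : ∃ k, i ∈ I k then (fun x : ∀ j : I (Nat.find hi), X j => x ⟨i, Nat.find_spec hi⟩) ''
      K (Nat.find hi) else {x₀ i}
  have hBc : ∀ i, IsCompact (B i) := fun i => by
    by_cases hi : ∃ k, i ∈ I k
    · simp only [B, dif_pos hi]
      exact (hK _).image (continuous_apply _)
    · simp only [B, dif_neg hi, isCompact_singleton]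
  have hmem : ∀ n, ∀ x ∈ ⋂ k ≤ n, cylinder (I k) (K k), ∀ i, (∃ k ≤ n, i ∈ I k) → x i ∈ B i := by
    rintro n x hx i ⟨k, hk, hik⟩
    have hi : ∃ k, i ∈ I k := ⟨k, hik⟩
    simp only [B, dif_pos hi]
    have hfind : Nat.find hi ≤ n := (Nat.find_min' hi hik).trans hk
    simp only [Set.mem_iInter] at hx
    exact ⟨_, hx _ hfind, rfl⟩
  have hBne : ∀ i, (B i).Nonempty := fun i => by
    by_cases hi : ∃ k, i ∈ I k
    · obtain ⟨k, hk⟩ := hi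
      obtain ⟨x, hx⟩ := h k
      exact ⟨x i, hmem k x hx i ⟨k, le_rfl, hk⟩⟩
    · simp only [B, dif_neg hi, Set.singleton_nonempty]
  choose b hb using hBne
  let C : ℕ → Set (∀ i, X i) := fun n => Set.univ.pi B ∩ ⋂ k ≤ n, cylinder (I k) (K k)
  have hcl : ∀ n, IsClosed (⋂ k ≤ n, cylinder (I k) (K k)) := fun n =>
    isClosed_iInter fun k => isClosed_iInter fun _ =>
      (hK k).isClosed.preimage (by fun_prop : Continuous (I k).restrict)
  have hBcl : IsCompact (Set.univ.pi B) := isCompact_univ_pi hBc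
  have hCne : (⋂ n, C n).Nonempty := by
    refine IsCompact.nonempty_iInter_of_sequence_nonempty_isCompact_isClosed C (fun n => ?_)
      (fun n => ?_) (hBcl.inter_right (hcl 0)) (fun n => hBcl.isClosed.inter (hcl n))
    · refine Set.inter_subset_inter_right _ ?_
      exact Set.biInter_subset_biInter_left fun k hk => Nat.le_succ_of_le hk
    · obtain ⟨x, hx⟩ := h n
      -- The first n cylinders ignore the other coordinates, which can thus be moved into their
      -- compact sets.
      refine ⟨fun i => if ∃ k ≤ n, i ∈ I k then x i else b i, fun i _ => ?_, ?_⟩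
      · simp only
        split_ifs with hi
        · exact hmem n x hx i hi
        · exact hb i
      · simp only [Set.mem_iInter] at hx ⊢
        intro k hk
        have := hx k hk
        rw [mem_cylinder] at this ⊢
        convert this using 1
        ext i
        simp only [Finset.restrict]
        rw [if_pos ⟨k, hk, i.2⟩]
  obtain ⟨x, hx⟩ := hCne
  refine ⟨x, ?_⟩
  simp only [Set.mem_iInter] at hx ⊢
  intro k
  have := (hx k).2
  simp only [Set.mem_iInter] at this
  exact this k le_rfl

variable [∀ i, MeasurableSpace (X i)] [∀ i, BorelSpace (X i)] [∀ i, PolishSpace (X i)]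
  {P : ∀ J : Finset ι, Measure (∀ j : J, X j)} [∀ J, IsProbabilityMeasure (P J)]

/-- If the limit ε were positive, inner regularity would replace the bases by compact sets at a
total loss below ε. Finite intersections of the compact cylinders would stay nonempty, and
compactness would give a point in every `A n`. -/
theorem projectiveFamilyContent_tendsto_zero (hP : IsProjectiveMeasureFamily P)
    {A : ℕ → Set (∀ i, X i)} (hA : ∀ n, A n ∈ measurableCylinders X) (hanti : Antitone A)
    (hinter : ⋂ n, A n = ∅) :
    Tendsto (fun n => projectiveFamilyContent hP (A n)) atTop (𝓝 0) := by
  have hmono : Antitone fun n => projectiveFamilyContent hP (A n) := fun m n hmn =>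
    projectiveFamilyContent_mono hP (hA n) (hA m) (hanti hmn)
  have hlim := tendsto_atTop_iInf hmono
  set ε := ⨅ n, projectiveFamilyContent hP (A n) with hε
  by_contra hne
  have hε0 : ε ≠ 0 := fun h => hne (h ▸ hlim)
  have hεle : ∀ n, ε ≤ projectiveFamilyContent hP (A n) := fun n => iInf_le _ n
  choose I S hS hAS using fun n => (mem_measurableCylinders (A n)).mp (hA n)
  obtain ⟨δ, hδpos, hδsum⟩ := ENNReal.exists_pos_sum_of_countable' hε0 ℕ
  have hK : ∀ n, ∃ K ⊆ S n, IsCompact K ∧ P (I n) (S n \ K) < δ n := fun n =>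
    (hS n).exists_isCompact_sdiff_lt (measure_ne_top _ _) (hδpos n).ne'
  choose K hKS hKc hKδ using hK
  have hKm : ∀ n, MeasurableSet (K n) := fun n => (hKc n).measurableSet
  have hcyl : ∀ n, cylinder (I n) (K n) ∈ measurableCylinders X := fun n =>
    cylinder_mem_measurableCylinders _ _ (hKm n)
  have hdiff : ∀ n, A n \ cylinder (I n) (K n) = cylinder (I n) (S n \ K n) := fun n => by
    rw [hAS n]; rfl
  have hne : ∀ n, (⋂ k ≤ n, cylinder (I k) (K k)).Nonempty := by
    intro n
    by_contra hempty
    rw [Set.not_nonempty_iff_eq_empty] at hempty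
    have hsub : A n ⊆ ⋃ k ∈ Finset.range (n + 1), cylinder (I k) (S k \ K k) := by
      intro x hx
      by_contra hx'
      have : x ∈ ⋂ k ≤ n, cylinder (I k) (K k) := by
        simp only [Set.mem_iInter]
        intro k hk
        by_contra hxk
        refine hx' ?_
        simp only [Set.mem_iUnion, Finset.mem_range]
        refine ⟨k, by omega, ?_⟩
        rw [← hdiff]
        exact ⟨hanti hk hx, hxk⟩
      rw [hempty] at this
      exact this
    have hlt : projectiveFamilyContent hP (A n) < ε := by
      calc projectiveFamilyContent hP (A n)
          ≤ ∑ k ∈ Finset.range (n + 1), projectiveFamilyContent hP (cylinder (I k) (S k \ K k)) := by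
            have hmem : ∀ k ∈ Finset.range (n + 1),
                cylinder (I k) (S k \ K k) ∈ measurableCylinders X := fun k _ =>
              cylinder_mem_measurableCylinders _ _ ((hS k).diff (hKm k))
            exact (projectiveFamilyContent_mono hP (hA n)
              (isSetRing_measurableCylinders.biUnion_mem _ hmem) hsub).trans
              (addContent_biUnion_le isSetRing_measurableCylinders hmem)
        _ ≤ ∑ k ∈ Finset.range (n + 1), δ k := by
            refine Finset.sum_le_sum fun k _ => ?_
            rw [projectiveFamilyContent_cylinder hP ((hS k).diff (hKm k))]
            exact (hKδ k).le
        _ ≤ ∑' k, δ k := ENNReal.sum_le_tsum _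
        _ < ε := hδsum
    exact absurd (hεle n) (not_le.mpr hlt)
  obtain ⟨x, hx⟩ := nonempty_iInter_cylinder_of_isCompact I K hKc hne
  have : x ∈ ⋂ n, A n := by
    simp only [Set.mem_iInter] at hx ⊢
    intro n
    rw [hAS n, mem_cylinder]
    exact hKS n (hx n)
  rw [hinter] at this
  exact this

/-- **Kolmogorov extension theorem** for Polish spaces. -/
theorem exists_isProjectiveLimit (hP : IsProjectiveMeasureFamily P) :
    ∃ Q : Measure (∀ i, X i), IsProjectiveLimit Q P := by
  have hsub : (projectiveFamilyContent hP).IsSigmaSubadditive := by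
    refine isSigmaSubadditive_of_addContent_iUnion_eq_tsum
      isSetRing_measurableCylinders fun f hf hf_Union hf' => ?_
    exact addContent_iUnion_eq_sum_of_tendsto_zero isSetRing_measurableCylinders
      (projectiveFamilyContent hP) (fun s hs => projectiveFamilyContent_ne_top _)
      (fun _ h1 h2 h3 => projectiveFamilyContent_tendsto_zero hP h1 h2 h3) hf hf_Union hf'
  refine ⟨(projectiveFamilyContent hP).measure isSetSemiring_measurableCylinders
    generateFrom_measurableCylinders.ge hsub, fun I => ?_⟩
  ext s hs
  rw [Measure.map_apply (Finset.measurable_restrict I) hs, AddContent.measure_eq]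
  rotate_left
  · exact generateFrom_measurableCylinders.symm
  · exact cylinder_mem_measurableCylinders _ _ hs
  exact projectiveFamilyContent_cylinder hP hs

end Kolmogorov

/-! ### Processes given by compensated Poisson integrals -/

section PoissonIntegral

variable {T S : Type*} [MeasurableSpace S]

theorem sum_coe_eq_sum_coe_of_subset {I J : Finset T} (h : J ⊆ I) {η : T → ℝ}
    (hη : ∀ t ∉ J, η t = 0) (x : I → ℝ) :
    ∑ j : J, η j * x ⟨j, h j.2⟩ = ∑ i : I, η i * x i := by
  refine Finset.sum_of_injOn (fun j : J => (⟨j, h j.2⟩ : I)) (fun i _ j _ hij => ?_)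
    (fun _ _ => Finset.mem_coe.mpr (Finset.mem_univ _)) (fun i _ hi => ?_) (fun _ _ => rfl)
  · exact Subtype.ext (congrArg (fun z : I => (z : T)) hij)
  · have : (i : T) ∉ J := fun hiJ => hi ⟨⟨i, hiJ⟩, by simp, rfl⟩
    rw [hη _ this, zero_mul]

theorem exists_finiteDimensional_law (m : Measure S) {f : T → S → ℝ} (hf : ∀ t, Measurable (f t))
    (hf2 : ∀ t, Integrable (fun s => f t s ^ 2) m) (I : Finset T) :
    ∃ P : Measure (I → ℝ), IsProbabilityMeasure P ∧ ∀ η : T → ℝ,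
      ∫ x, Complex.exp ((∑ i : I, η i * x i : ℝ) * Complex.I) ∂P =
        Complex.exp (∫ s, compExp (∑ i : I, η i * f i s) ∂m) := by
  let F : S → EuclideanSpace ℝ I := fun s => WithLp.toLp 2 fun i => f i s
  have hF : Measurable F := (WithLp.measurable_toLp 2 _).comp (measurable_pi_lambda _ fun i => hf i)
  have hF2 : Integrable (fun s => ‖F s‖ ^ 2) m := by
    simp only [EuclideanSpace.norm_sq_eq, F, Real.norm_eq_abs, sq_abs]
    exact integrable_finsetSum _ fun i _ => hf2 i
  obtain ⟨μ, hμ, hμF⟩ := isCharFun_exp_integral_compExp m hF hF2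
  have hm : Measurable (WithLp.ofLp : EuclideanSpace ℝ I → I → ℝ) := WithLp.measurable_ofLp 2 _
  refine ⟨μ.map WithLp.ofLp, Measure.isProbabilityMeasure_map hm.aemeasurable, fun η => ?_⟩
  have h := hμF (WithLp.toLp 2 fun i => η i)
  rw [charFun_apply] at h
  rw [integral_map hm.aemeasurable (Continuous.aestronglyMeasurable (by fun_prop))]
  simpa only [PiLp.inner_apply, RCLike.inner_apply, conj_trivial, F] using h

/-- Existence of a process all of whose finite linear combinations have the law of compensated
Poisson integrals. -/
theorem exists_process_of_square_integrable (m : Measure S) {f : T → S → ℝ}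
    (hf : ∀ t, Measurable (f t)) (hf2 : ∀ t, Integrable (fun s => f t s ^ 2) m) :
    ∃ Q : Measure (T → ℝ), IsProbabilityMeasure Q ∧ ∀ c : T →₀ ℝ,
      ∫ ω, Complex.exp ((Finsupp.linearCombination ℝ ω c : ℝ) * Complex.I) ∂Q =
        Complex.exp (∫ s, compExp (Finsupp.linearCombination ℝ (fun t => f t s) c) ∂m) := by
  classical
  choose P hP hPf using exists_finiteDimensional_law m hf hf2
  -- Consistency holds because the prescribed characteristic function depends on the coefficients
  -- only through the combination of the f t; coefficients on J extend by zero to I.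
  have hproj : IsProjectiveMeasureFamily (α := fun _ : T => ℝ) P := by
    intro I J hJI
    have hr : Measurable (Finset.restrict₂ (π := fun _ : T => ℝ) hJI) := Finset.measurable_restrict₂ hJI
    have : IsProbabilityMeasure ((P I).map (Finset.restrict₂ (π := fun _ : T => ℝ) hJI)) :=
      Measure.isProbabilityMeasure_map hr.aemeasurable
    refine Measure.ext_of_charFunDual (funext fun L => ?_)
    let η : T → ℝ := fun t => if h : t ∈ J then L (Pi.single ⟨t, h⟩ 1) else 0
    have hη : ∀ t ∉ J, η t = 0 := fun t ht => dif_neg ht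
    have hL : ∀ v : J → ℝ, L v = ∑ j : J, η j * v j := fun v => by
      conv_lhs => rw [pi_eq_sum_univ' v]
      rw [map_sum]
      refine Finset.sum_congr rfl fun j _ => ?_
      rw [map_smul, smul_eq_mul, mul_comm]
      congr 1
      simp only [η, dif_pos j.2]
    rw [charFunDual_apply, charFunDual_apply, integral_map hr.aemeasurable
      (Continuous.aestronglyMeasurable (by fun_prop))]
    simp only [hL]
    rw [hPf J η]
    have h1 : ∀ x : I → ℝ, ∑ j : J, η j * Finset.restrict₂ (π := fun _ : T => ℝ) hJI x j
        = ∑ i : I, η i * x i := fun x => sum_coe_eq_sum_coe_of_subset hJI hη x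
    have h2 : ∀ s, ∑ j : J, η j * f j s = ∑ i : I, η i * f i s :=
      fun s => sum_coe_eq_sum_coe_of_subset hJI hη fun i => f i s
    simp only [h1, h2]
    rw [hPf I η]
  obtain ⟨Q, hQ⟩ := exists_isProjectiveLimit hproj
  have hQp : IsProbabilityMeasure Q := hQ.isProbabilityMeasure
  refine ⟨Q, hQp, fun c => ?_⟩
  have hlin : ∀ g : T → ℝ, Finsupp.linearCombination ℝ g c = ∑ i : c.support, c i * g i := fun g => by
    rw [Finsupp.linearCombination_apply, Finsupp.sum, ← Finset.sum_coe_sort]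
    simp only [smul_eq_mul]
  simp only [hlin]
  rw [← hPf c.support c, ← hQ c.support, integral_map (Finset.measurable_restrict _).aemeasurable
    (Continuous.aestronglyMeasurable (by fun_prop))]
  rfl

end PoissonIntegral

/-! ### Lévy processes with a given square integrable Lévy measure -/

theorem Complex.norm_exp_sub_one_le_of_re_nonpos {z : ℂ} (hz : z.re ≤ 0) :
    ‖Complex.exp z - 1‖ ≤ ‖z‖ := by
  have h := Convex.norm_image_sub_le_of_norm_deriv_le (f := Complex.exp) (s := {w : ℂ | w.re ≤ 0})
    (C := 1) (fun x _ => Complex.differentiableAt_exp) (fun x hx => ?_)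
    (convex_halfSpace_re_le 0) (x := 0) (y := z) (by simp) hz
  · simpa using h
  · rw [Complex.deriv_exp, Complex.norm_exp]
    exact Real.exp_le_one_iff.mpr hx

/-- The mean value inequality is applied on a half-disc, which is convex; there the derivative exp w
- 1 has norm at most |z|. -/
theorem Complex.norm_exp_sub_one_sub_le_of_re_nonpos {z : ℂ} (hz : z.re ≤ 0) :
    ‖Complex.exp z - 1 - z‖ ≤ ‖z‖ ^ 2 := by
  have h := Convex.norm_image_sub_le_of_norm_hasDerivWithin_le
    (f := fun w : ℂ => Complex.exp w - 1 - w) (f' := fun w => Complex.exp w - 1)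
    (s := {w : ℂ | w.re ≤ 0} ∩ Metric.closedBall 0 ‖z‖) (C := ‖z‖)
    (fun x _ => (((Complex.hasDerivAt_exp x).sub_const 1).sub (hasDerivAt_id x)).hasDerivWithinAt)
    (fun x hx => (Complex.norm_exp_sub_one_le_of_re_nonpos hx.1).trans (by simpa using hx.2))
    ((convex_halfSpace_re_le 0).inter (convex_closedBall _ _)) (x := 0) (y := z) (by simp)
    ⟨hz, by simp⟩
  simpa [sq] using h

/-- The Lévy–Khintchine exponent of a spectrally one-sided square integrable Lévy measure. -/
noncomputable def levyExponent (Λ : Measure ℝ) (θ : ℝ) : ℂ := ∫ y, compExp (θ * y) ∂Λ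

section LevyProcess

variable {Λ : Measure ℝ}

theorem re_levyExponent_nonpos (hΛ : Integrable (fun y : ℝ => y ^ 2) Λ) (θ : ℝ) :
    (levyExponent Λ θ).re ≤ 0 := by
  have h := integral_re (integrable_compExp_mul hΛ θ)
  simp only [RCLike.re_to_complex] at h
  rw [levyExponent, ← h]
  exact integral_nonpos fun y => re_compExp_nonpos _

theorem norm_levyExponent_le (hΛ : Integrable (fun y : ℝ => y ^ 2) Λ) (θ : ℝ) :
    ‖levyExponent Λ θ‖ ≤ 2 * θ ^ 2 * ∫ y, y ^ 2 ∂Λ := by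
  rw [← integral_const_mul]
  refine norm_integral_le_of_norm_le (hΛ.const_mul _) (ae_of_all _ fun y => ?_)
  exact (norm_compExp_le _).trans (le_of_eq (by ring))

/-- The jump function of the process at time `t`: a jump `-y` at every time `s ∈ (0, t]`. -/
noncomputable def jumpFunction (t : ℝ≥0) (p : ℝ × ℝ) : ℝ :=
  (Set.Ioc 0 (t : ℝ)).indicator (fun _ => (1 : ℝ)) p.1 * (-p.2)

theorem measurable_jumpFunction (t : ℝ≥0) : Measurable (jumpFunction t) := by
  unfold jumpFunction
  have : Measurable ((Set.Ioc 0 (t : ℝ)).indicator (fun _ : ℝ => (1 : ℝ))) :=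
    measurable_const.indicator measurableSet_Ioc
  fun_prop

theorem integrable_indicator_Ioc {R : Type*} [NormedRing R] (s t : ℝ) :
    Integrable ((Set.Ioc s t).indicator fun _ : ℝ => (1 : R)) :=
  (integrable_indicator_iff measurableSet_Ioc).mpr
    (integrableOn_const (by rw [Real.volume_Ioc]; exact ENNReal.ofReal_ne_top))

theorem integrable_jumpFunction_sq [SFinite Λ] (hΛ : Integrable (fun y : ℝ => y ^ 2) Λ) (t : ℝ≥0) :
    Integrable (fun p => jumpFunction t p ^ 2) ((volume : Measure ℝ).prod Λ) := by
  refine ((integrable_indicator_Ioc (R := ℝ) 0 t).mul_prod hΛ).congr (ae_of_all _ fun p => ?_)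
  by_cases h : p.1 ∈ Set.Ioc 0 (t : ℝ) <;> simp [jumpFunction, h]

theorem jumpFunction_sub {s t : ℝ≥0} (hst : s ≤ t) (p : ℝ × ℝ) :
    jumpFunction t p - jumpFunction s p =
      (Set.Ioc (s : ℝ) t).indicator (fun _ => (1 : ℝ)) p.1 * (-p.2) := by
  have hst' : (s : ℝ) ≤ t := hst
  have hs : (0 : ℝ) ≤ s := s.2
  rw [jumpFunction, jumpFunction, ← sub_mul]
  congr 1
  simp only [Set.indicator, Set.mem_Ioc]
  split_ifs <;> grind

/-- `Q` is the law of a process with independent increments of exponent `levyExponent Λ`. -/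
def HasLevyCharFun (Q : Measure (ℝ≥0 → ℝ)) (Λ : Measure ℝ) : Prop :=
  ∀ c : ℝ≥0 →₀ ℝ, ∫ ω, Complex.exp ((Finsupp.linearCombination ℝ ω c : ℝ) * Complex.I) ∂Q =
    Complex.exp (∫ p, compExp (Finsupp.linearCombination ℝ (fun t => jumpFunction t p) c)
      ∂((volume : Measure ℝ).prod Λ))

variable {Q : Measure (ℝ≥0 → ℝ)}

/-- At each time s at most one increment is active, so the compensated exponential of the sum is the
sum of the compensated exponentials. The argument is -ξ because jumps are -y. -/
theorem HasLevyCharFun.increments [SFinite Λ] (hQ : HasLevyCharFun Q Λ)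
    (hΛ : Integrable (fun y : ℝ => y ^ 2) Λ) {n : ℕ} {t : Fin (n + 1) → ℝ≥0} (ht : Monotone t)
    (ξ : Fin n → ℝ) :
    ∫ ω, Complex.exp ((∑ j, ξ j * (ω (t j.succ) - ω (t j.castSucc)) : ℝ) * Complex.I) ∂Q =
      ∏ j, Complex.exp (((t j.succ : ℝ) - t j.castSucc : ℝ) * levyExponent Λ (-ξ j)) := by
  let c : ℝ≥0 →₀ ℝ := ∑ j, ξ j • (Finsupp.single (t j.succ) 1 - Finsupp.single (t j.castSucc) 1)
  have hc : ∀ g : ℝ≥0 → ℝ, Finsupp.linearCombination ℝ g c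
      = ∑ j, ξ j * (g (t j.succ) - g (t j.castSucc)) := fun g => by
    simp [c, map_sum, Finsupp.linearCombination_single]
  have h := hQ c
  simp only [hc] at h
  rw [h, ← Complex.exp_sum]
  congr 1
  have hmono : ∀ j : Fin n, t j.castSucc ≤ t j.succ := fun j => ht j.castSucc_le_succ
  have hdisj : ∀ i j : Fin n, ∀ s : ℝ, s ∈ Set.Ioc (t i.castSucc : ℝ) (t i.succ) →
      s ∈ Set.Ioc (t j.castSucc : ℝ) (t j.succ) → i = j := by
    intro i j s hi hj
    by_contra hne
    rcases lt_or_gt_of_ne hne with hlt | hlt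
    · have : (t i.succ : ℝ) ≤ t j.castSucc := ht (by
        rw [Fin.le_iff_val_le_val]; simpa using hlt)
      linarith [hi.2, hj.1]
    · have : (t j.succ : ℝ) ≤ t i.castSucc := ht (by
        rw [Fin.le_iff_val_le_val]; simpa using hlt)
      linarith [hj.2, hi.1]
  have hpt : ∀ p : ℝ × ℝ,
      compExp (∑ j, ξ j * (jumpFunction (t j.succ) p - jumpFunction (t j.castSucc) p)) =
      ∑ j, (Set.Ioc (t j.castSucc : ℝ) (t j.succ)).indicator (fun _ => (1 : ℂ)) p.1 *
        compExp (-ξ j * p.2) := fun p => by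
    simp only [jumpFunction_sub (hmono _)]
    by_cases hp : ∃ j : Fin n, p.1 ∈ Set.Ioc (t j.castSucc : ℝ) (t j.succ)
    · obtain ⟨j, hj⟩ := hp
      have hother : ∀ i, i ≠ j → p.1 ∉ Set.Ioc (t i.castSucc : ℝ) (t i.succ) :=
        fun i hi hmem => hi (hdisj i j p.1 hmem hj)
      rw [Finset.sum_eq_single j (fun i _ hi => by simp [Set.indicator_of_notMem (hother i hi)])
        (by simp), Finset.sum_eq_single j
        (fun i _ hi => by simp [Set.indicator_of_notMem (hother i hi)]) (by simp),
        Set.indicator_of_mem hj, Set.indicator_of_mem hj]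
      simp
    · push Not at hp
      rw [Finset.sum_eq_zero fun j _ => by rw [Set.indicator_of_notMem (hp j)]; simp,
        Finset.sum_eq_zero fun j _ => by rw [Set.indicator_of_notMem (hp j)]; simp]
      simp
  simp only [hpt]
  rw [integral_finsetSum _ fun j _ => (integrable_indicator_Ioc _ _).mul_prod
    (integrable_compExp_mul hΛ _)]
  refine Finset.sum_congr rfl fun j _ => ?_
  rw [integral_prod_mul ((Set.Ioc (t j.castSucc : ℝ) (t j.succ)).indicator fun _ => (1 : ℂ))
    (fun y => compExp (-ξ j * y)), levyExponent, integral_indicator measurableSet_Ioc]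
  have hle : (t j.castSucc : ℝ) ≤ t j.succ := hmono j
  simp [Real.volume_real_Ioc_of_le hle]

theorem HasLevyCharFun.increment [SFinite Λ] (hQ : HasLevyCharFun Q Λ)
    (hΛ : Integrable (fun y : ℝ => y ^ 2) Λ) {s t : ℝ≥0} (hst : s ≤ t) (ξ : ℝ) :
    charFun (Q.map fun ω => ω t - ω s) ξ =
      Complex.exp (((t : ℝ) - s : ℝ) * levyExponent Λ (-ξ)) := by
  have hm : Monotone ![s, t] := by
    intro i j hij
    fin_cases i <;> fin_cases j <;> simp_all
  have h := hQ.increments hΛ (n := 1) hm (fun _ => ξ)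
  rw [charFun_apply_real, integral_map (by fun_prop) (Continuous.aestronglyMeasurable (by fun_prop))]
  simpa using h

theorem HasLevyCharFun.ae_zero [IsProbabilityMeasure Q] (hQ : HasLevyCharFun Q Λ) :
    ∀ᵐ ω ∂Q, ω 0 = 0 := by
  have hm : Measurable fun ω : ℝ≥0 → ℝ => ω 0 := measurable_pi_apply 0
  have : IsProbabilityMeasure (Q.map fun ω : ℝ≥0 → ℝ => ω 0) :=
    Measure.isProbabilityMeasure_map hm.aemeasurable
  have h : Q.map (fun ω : ℝ≥0 → ℝ => ω 0) = Measure.dirac 0 := by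
    refine Measure.ext_of_charFun (funext fun ξ => ?_)
    have h := hQ (Finsupp.single 0 ξ)
    simp only [Finsupp.linearCombination_single] at h
    rw [charFun_apply_real, integral_map hm.aemeasurable
      (Continuous.aestronglyMeasurable (by fun_prop)), charFun_dirac]
    simpa [jumpFunction] using h
  have h2 : ∀ᵐ x ∂(Q.map fun ω : ℝ≥0 → ℝ => ω 0), x = 0 := by
    rw [h, ae_dirac_eq]
    exact Filter.eventually_pure.mpr rfl
  exact ae_of_ae_map hm.aemeasurable h2

theorem HasLevyCharFun.eval [SFinite Λ] [IsProbabilityMeasure Q] (hQ : HasLevyCharFun Q Λ)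
    (hΛ : Integrable (fun y : ℝ => y ^ 2) Λ) (t : ℝ≥0) (ξ : ℝ) :
    charFun (Q.map fun ω => ω t) ξ = Complex.exp ((t : ℝ) * levyExponent Λ (-ξ)) := by
  have h := hQ.increment hΛ (zero_le (a := t)) ξ
  have h2 : Q.map (fun ω : ℝ≥0 → ℝ => ω t) = Q.map fun ω => ω t - ω 0 := by
    refine Measure.map_congr ?_
    filter_upwards [hQ.ae_zero] with ω hω
    rw [hω, sub_zero]
  rw [h2, h]
  simp

/-- Tails are controlled by the mean of 1 - charFun over |x| ≤ 2/r, which is linear in the time lag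
since |exp z - 1| ≤ |z| for Re z ≤ 0. This yields stochastic continuity. -/
theorem HasLevyCharFun.measureReal_le [SFinite Λ] [IsProbabilityMeasure Q]
    (hQ : HasLevyCharFun Q Λ) (hΛ : Integrable (fun y : ℝ => y ^ 2) Λ) {r : ℝ} (hr : 0 < r) :
    ∃ C, ∀ s t : ℝ≥0, Q.real {ω | r < |ω t - ω s|} ≤ C * |(t : ℝ) - s| := by
  set V := ∫ y, y ^ 2 ∂Λ with hV
  have hV0 : 0 ≤ V := integral_nonneg fun y => sq_nonneg y
  set D := 2 * (2 * r⁻¹) ^ 2 * V with hD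
  refine ⟨2⁻¹ * r * (D * (4 * r⁻¹)), ?_⟩
  have key : ∀ s t : ℝ≥0, s ≤ t →
      Q.real {ω | r < |ω t - ω s|} ≤ 2⁻¹ * r * (D * (4 * r⁻¹)) * |(t : ℝ) - s| := by
    intro s t hst
    have hst' : (0 : ℝ) ≤ (t : ℝ) - s := sub_nonneg.mpr hst
    have hm : Measurable fun ω : ℝ≥0 → ℝ => ω t - ω s := by fun_prop
    have := Measure.isProbabilityMeasure_map hm.aemeasurable (μ := Q)
    have h := measureReal_abs_gt_le_integral_charFun (μ := Q.map fun ω => ω t - ω s) hr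
    rw [map_measureReal_apply hm (measurableSet_lt measurable_const continuous_abs.measurable)] at h
    refine le_trans h ?_
    have hb : ∀ x ∈ Set.uIoc (-2 * r⁻¹) (2 * r⁻¹),
        ‖1 - charFun (Q.map fun ω => ω t - ω s) x‖ ≤ D * |(t : ℝ) - s| := by
      intro x hx
      have hr' : 0 < r⁻¹ := inv_pos.mpr hr
      rw [Set.uIoc_of_le (by linarith)] at hx
      have hx2 : x ^ 2 ≤ (2 * r⁻¹) ^ 2 := sq_le_sq' (by linarith [hx.1]) hx.2
      rw [hQ.increment hΛ hst, norm_sub_rev, abs_of_nonneg hst']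
      refine (Complex.norm_exp_sub_one_le_of_re_nonpos ?_).trans ?_
      · rw [Complex.re_ofReal_mul]
        exact mul_nonpos_of_nonneg_of_nonpos hst' (re_levyExponent_nonpos hΛ _)
      · rw [norm_mul, Complex.norm_real, Real.norm_of_nonneg hst', mul_comm]
        gcongr
        refine (norm_levyExponent_le hΛ _).trans ?_
        rw [neg_sq, hD]
        gcongr
    have h2 := intervalIntegral.norm_integral_le_of_norm_le_const hb
    have h3 : |2 * r⁻¹ - -2 * r⁻¹| = 4 * r⁻¹ := by
      rw [abs_of_nonneg] <;> ring_nf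
      positivity
    rw [h3] at h2
    calc _ ≤ 2⁻¹ * r * (D * |(t : ℝ) - s| * (4 * r⁻¹)) := by gcongr
      _ = _ := by ring
  intro s t
  rcases le_total s t with h | h
  · exact key s t h
  · have := key t s h
    rw [abs_sub_comm] at this
    simpa only [abs_sub_comm] using this

/-- The coordinate process is a Lévy process. -/
theorem HasLevyCharFun.isLevyProcess [SFinite Λ] [IsProbabilityMeasure Q]
    (hQ : HasLevyCharFun Q Λ) (hΛ : Integrable (fun y : ℝ => y ^ 2) Λ) :
    IsLevyProcess (fun t (ω : ℝ≥0 → ℝ) => ω t) Q where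
  measurable t := measurable_pi_apply t
  start_zero := hQ.ae_zero
  indep_increments := by
    intro n t ht
    rw [iIndepFun_iff_charFun_pi (fun i => by fun_prop)]
    intro ξ
    have h := hQ.increments hΛ ht ξ
    rw [charFun_apply, integral_map (by fun_prop) (Continuous.aestronglyMeasurable (by fun_prop))]
    simp only [hQ.increment hΛ (ht (Fin.castSucc_le_succ _))]
    rw [← h]
    simp [PiLp.inner_apply, mul_comm]
  stationary_increments s t := by
    have m1 : Measurable fun ω : ℝ≥0 → ℝ => ω (s + t) - ω s := by fun_prop
    have m2 : Measurable fun ω : ℝ≥0 → ℝ => ω t := measurable_pi_apply t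
    refine ⟨m1.aemeasurable, m2.aemeasurable, ?_⟩
    have := Measure.isProbabilityMeasure_map m1.aemeasurable (μ := Q)
    have := Measure.isProbabilityMeasure_map m2.aemeasurable (μ := Q)
    refine Measure.ext_of_charFun (funext fun ξ => ?_)
    rw [hQ.increment hΛ le_self_add, hQ.eval hΛ]
    simp
  stochastically_continuous t := by
    rw [tendstoInMeasure_iff_measureReal_norm]
    intro ε hε
    -- Halving ε turns the non-strict threshold of convergence in measure into the strict one of the
    -- tail bound.
    obtain ⟨C, hC⟩ := hQ.measureReal_le hΛ (half_pos hε)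
    refine squeeze_zero (g := fun s : ℝ≥0 => C * |(s : ℝ) - t|) (fun s => measureReal_nonneg)
      (fun s => le_trans (measureReal_mono fun ω hω => ?_) (hC t s)) ?_
    · have hω : ε ≤ ‖ω s - ω t‖ := hω
      exact lt_of_lt_of_le (half_lt_self hε) hω
    · have : Continuous fun s : ℝ≥0 => C * |(s : ℝ) - t| := by fun_prop
      simpa using this.tendsto t

theorem exists_hasLevyCharFun [SFinite Λ] (hΛ : Integrable (fun y : ℝ => y ^ 2) Λ) :
    ∃ Q : Measure (ℝ≥0 → ℝ), IsProbabilityMeasure Q ∧ HasLevyCharFun Q Λ :=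
  exists_process_of_square_integrable _ measurable_jumpFunction (integrable_jumpFunction_sq hΛ)

end LevyProcess

/-! ### Density of the Schwartz space in `C₀` -/

section Density

theorem ZeroAtInftyContinuousMap.norm_apply_le (f : C₀(ℝ, ℂ)) (x : ℝ) : ‖f x‖ ≤ ‖f‖ := by
  rw [← ZeroAtInftyContinuousMap.norm_toBCF_eq_norm]
  exact f.toBCF.norm_coe_le_norm x

theorem ZeroAtInftyContinuousMap.norm_le_of_forall {f : C₀(ℝ, ℂ)} {C : ℝ} (hC : 0 ≤ C)
    (h : ∀ x, ‖f x‖ ≤ C) : ‖f‖ ≤ C := by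
  rw [← ZeroAtInftyContinuousMap.norm_toBCF_eq_norm]
  exact (BoundedContinuousFunction.norm_le hC).mpr h

/-- A smooth approximant within ε/2 is cut off by a bump equal to 1 wherever g is not below ε/2;
smoothing and cutting off each cost at most ε/2. -/
theorem ZeroAtInftyContinuousMap.exists_schwartz_approx (g : C₀(ℝ, ℂ)) {ε : ℝ} (hε : 0 < ε) :
    ∃ φ : 𝓢(ℝ, ℂ), ∀ u, ‖g u - φ u‖ ≤ ε := by
  obtain ⟨g₁, hg₁, hgg⟩ :=
    (ZeroAtInftyContinuousMap.uniformContinuous g).exists_contDiff_dist_le (half_pos hε)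
  have hz : ∀ᶠ x in cocompact ℝ, ‖g x‖ < ε / 2 := by
    have := (zero_at_infty g).norm
    rw [norm_zero] at this
    exact this.eventually_lt_const (half_pos hε)
  rw [← Metric.cobounded_eq_cocompact] at hz
  obtain ⟨R, -, hR⟩ := (Metric.hasBasis_cobounded_compl_closedBall (0 : ℝ)).eventually_iff.mp hz
  let χ : ContDiffBump (0 : ℝ) := ⟨max R 1, max R 1 + 1, by positivity, by linarith⟩
  have hsupp : HasCompactSupport fun x => (χ x : ℂ) * g₁ x := by
    have h1 : HasCompactSupport fun x => (χ x : ℂ) :=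
      χ.hasCompactSupport.comp_left (g := fun r : ℝ => (r : ℂ)) Complex.ofReal_zero
    exact h1.mul_right
  have hsm : ContDiff ℝ (⊤ : ℕ∞) fun x => (χ x : ℂ) * g₁ x :=
    (Complex.ofRealCLM.contDiff.comp χ.contDiff).mul hg₁
  refine ⟨hsupp.toSchwartzMap hsm, fun u => ?_⟩
  have hval : (hsupp.toSchwartzMap hsm) u = (χ u : ℂ) * g₁ u := rfl
  rw [hval]
  have h0 := χ.nonneg (x := u)
  have h1 := χ.le_one (x := u)
  have hd : ‖g u - g₁ u‖ ≤ ε / 2 := by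
    rw [← dist_eq_norm, dist_comm]
    exact (hgg u).le
  have e : g u - (χ u : ℂ) * g₁ u = (χ u : ℂ) * (g u - g₁ u) + ((1 - χ u : ℝ) : ℂ) * g u := by
    push_cast; ring
  have hb : (1 - χ u) * ‖g u‖ ≤ ε / 2 := by
    by_cases hu : u ∈ Metric.closedBall (0 : ℝ) (max R 1)
    · rw [χ.one_of_mem_closedBall hu]
      simp; linarith
    · have : ‖g u‖ < ε / 2 := hR fun h => hu (Metric.closedBall_subset_closedBall (le_max_left _ _) h)
      nlinarith [norm_nonneg (g u)]
  calc ‖g u - (χ u : ℂ) * g₁ u‖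
      ≤ ‖(χ u : ℂ) * (g u - g₁ u)‖ + ‖((1 - χ u : ℝ) : ℂ) * g u‖ := by rw [e]; exact norm_add_le _ _
    _ = χ u * ‖g u - g₁ u‖ + (1 - χ u) * ‖g u‖ := by
      rw [norm_mul, norm_mul, Complex.norm_real, Complex.norm_real, Real.norm_of_nonneg h0,
        Real.norm_of_nonneg (by linarith)]
    _ ≤ 1 * (ε / 2) + ε / 2 := by gcongr
    _ = ε := by ring

end Density

/-! ### The transition semigroup -/

section Semigroup

variable {a lam : ℝ} {Ω : Type*} [MeasurableSpace Ω] {P : Measure Ω} [IsProbabilityMeasure P]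
  {X : ℝ≥0 → Ω → ℝ}

theorem norm_integral_comp_add_le {f : ℝ → ℂ} {M : ℝ} (hf : ∀ x, ‖f x‖ ≤ M) (Y : Ω → ℝ) (u : ℝ) :
    ‖∫ ω, f (u + Y ω) ∂P‖ ≤ M := by
  have := norm_integral_le_of_norm_le_const (μ := P) (f := fun ω => f (u + Y ω))
    (ae_of_all _ fun ω => hf _)
  simpa using this

theorem norm_integral_comp_add_sub_le {f g : ℝ → ℂ} {ε : ℝ} (hf : Continuous f) (hg : Continuous g)
    {M N : ℝ} (hfM : ∀ x, ‖f x‖ ≤ M) (hgN : ∀ x, ‖g x‖ ≤ N) (hfg : ∀ x, ‖f x - g x‖ ≤ ε)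
    {Y : Ω → ℝ} (hY : Measurable Y) (u : ℝ) :
    ‖(∫ ω, f (u + Y ω) ∂P) - ∫ ω, g (u + Y ω) ∂P‖ ≤ ε := by
  have hi {h : ℝ → ℂ} {K : ℝ} (hh : Continuous h) (hK : ∀ x, ‖h x‖ ≤ K) :
      Integrable (fun ω => h (u + Y ω)) P :=
    Integrable.of_bound (hh.measurable.comp (hY.const_add u)).aestronglyMeasurable K
      (ae_of_all _ fun ω => hK _)
  rw [← integral_sub (hi hf hfM) (hi hg hgN)]
  exact norm_integral_comp_add_le (f := fun x => f x - g x) hfg Y u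

theorem SchwartzMap.exists_norm_le (φ : 𝓢(ℝ, ℂ)) : ∃ M, ∀ x, ‖φ x‖ ≤ M :=
  ⟨‖φ.toZeroAtInfty‖, fun x => ZeroAtInftyContinuousMap.norm_apply_le φ.toZeroAtInfty x⟩

/-- The process `X` has the characteristic exponent `levySymbol a lam`. -/
def HasSymbol (a lam : ℝ) (X : ℝ≥0 → Ω → ℝ) (P : Measure Ω) : Prop :=
  ∀ (t : ℝ≥0) (k : ℝ), ∫ ω, Complex.exp ((2 * Real.pi * k * X t ω : ℝ) * Complex.I) ∂P =
    Complex.exp ((t : ℝ) * levySymbol a lam k)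

theorem HasSymbol.integral_comp_add (hX : HasSymbol a lam X P) (hm : ∀ t, Measurable (X t))
    (φ : 𝓢(ℝ, ℂ)) (t : ℝ≥0) (u : ℝ) :
    ∫ ω, φ (u + X t ω) ∂P = ∫ k : ℝ, Complex.exp ((2 * Real.pi * k * u : ℝ) * Complex.I) *
      (Complex.exp ((t : ℝ) * levySymbol a lam k) * 𝓕 (φ : ℝ → ℂ) k) := by
  have hint : Integrable (Function.uncurry fun (ω : Ω) (k : ℝ) =>
      Complex.exp ((2 * Real.pi * k * (u + X t ω) : ℝ) * Complex.I) * 𝓕 (φ : ℝ → ℂ) k)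
      (P.prod volume) := by
    refine (φ.integrable_fourier.norm.comp_snd P).mono' (Measurable.aestronglyMeasurable ?_)
      (ae_of_all _ fun p => ?_)
    · have h1 := φ.continuous_fourier.measurable
      have h2 := hm t
      simp only [Function.uncurry_def]
      fun_prop
    · simp only [Function.uncurry_def, norm_mul, Complex.norm_exp_ofReal_mul_I, one_mul]
      exact le_rfl
  simp only [φ.eq_integral_fourier (u + X t _)]
  rw [integral_integral_swap hint]
  refine integral_congr_ae (ae_of_all _ fun k => ?_)
  have e : ∀ ω, Complex.exp ((2 * Real.pi * k * (u + X t ω) : ℝ) * Complex.I) * 𝓕 (φ : ℝ → ℂ) k =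
      Complex.exp ((2 * Real.pi * k * u : ℝ) * Complex.I) *
        (Complex.exp ((2 * Real.pi * k * X t ω : ℝ) * Complex.I) * 𝓕 (φ : ℝ → ℂ) k) := fun ω => by
    rw [← mul_assoc, ← Complex.exp_add]
    congr 2
    push_cast
    ring
  simp only [e]
  rw [integral_const_mul, integral_mul_const, hX t k]

variable (ha : 0 < a) (hlam : 0 < lam)
include ha hlam

theorem re_mul_levySymbol_nonpos (t : ℝ≥0) (k : ℝ) : ((t : ℝ) * levySymbol a lam k : ℂ).re ≤ 0 := by
  rw [Complex.re_ofReal_mul]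
  exact mul_nonpos_of_nonneg_of_nonpos t.coe_nonneg (re_levySymbol_nonpos ha hlam k)

theorem norm_exp_mul_levySymbol_le (t : ℝ≥0) (k : ℝ) :
    ‖Complex.exp ((t : ℝ) * levySymbol a lam k)‖ ≤ 1 := by
  rw [Complex.norm_exp]
  exact Real.exp_le_one_iff.mpr (re_mul_levySymbol_nonpos ha hlam t k)

theorem continuous_levySymbol : Continuous (levySymbol a lam) :=
  (hasTemperateGrowth_levySymbol ha hlam).1.continuous

theorem integrable_semigroup_integrand (φ : 𝓢(ℝ, ℂ)) (t : ℝ≥0) (u : ℝ) :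
    Integrable fun k : ℝ => Complex.exp ((2 * Real.pi * k * u : ℝ) * Complex.I) *
      (Complex.exp ((t : ℝ) * levySymbol a lam k) * 𝓕 (φ : ℝ → ℂ) k) := by
  have hc := continuous_levySymbol ha hlam
  refine integrable_exp_mul (c := fun k => 2 * Real.pi * k * u) ?_ (by fun_prop)
  exact φ.integrable_fourier.bdd_mul (c := 1) (Continuous.aestronglyMeasurable (by fun_prop))
    (ae_of_all _ fun k => norm_exp_mul_levySymbol_le ha hlam t k)

/-- First order Taylor expansion of the transition semigroup on Schwartz functions. -/
theorem HasSymbol.norm_integral_add_sub_le (hX : HasSymbol a lam X P)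
    (hm : ∀ t, Measurable (X t)) (φ : 𝓢(ℝ, ℂ)) (s h : ℝ≥0) (u : ℝ) :
    ‖(∫ ω, φ (u + X (s + h) ω) ∂P) - (∫ ω, φ (u + X s ω) ∂P)
        - (h : ℝ) * ∫ ω, levyOpSchwartz a lam φ (u + X s ω) ∂P‖ ≤
      (h : ℝ) ^ 2 * ∫ k, ‖𝓕 (levyOpSchwartz a lam (levyOpSchwartz a lam φ) : ℝ → ℂ) k‖ := by
  have i1 := integrable_semigroup_integrand ha hlam φ (s + h) u
  have i2 := integrable_semigroup_integrand ha hlam φ s u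
  have i3 := integrable_semigroup_integrand ha hlam (levyOpSchwartz a lam φ) s u
  have i12 : Integrable fun k : ℝ => Complex.exp ((2 * Real.pi * k * u : ℝ) * Complex.I) *
      (Complex.exp (((s + h : ℝ≥0) : ℝ) * levySymbol a lam k) * 𝓕 (φ : ℝ → ℂ) k) -
      Complex.exp ((2 * Real.pi * k * u : ℝ) * Complex.I) *
      (Complex.exp ((s : ℝ) * levySymbol a lam k) * 𝓕 (φ : ℝ → ℂ) k) := i1.sub i2
  rw [hX.integral_comp_add hm, hX.integral_comp_add hm, hX.integral_comp_add hm,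
    ← integral_sub i1 i2, ← integral_const_mul, ← integral_sub i12 (i3.const_mul _),
    ← integral_const_mul]
  refine norm_integral_le_of_norm_le
    ((SchwartzMap.integrable_fourier _).norm.const_mul _) (ae_of_all _ fun k => ?_)
  simp only [fourier_levyOpSchwartz ha hlam]
  have e : Complex.exp (((s + h : ℝ≥0) : ℝ) * levySymbol a lam k) =
      Complex.exp ((s : ℝ) * levySymbol a lam k) * Complex.exp ((h : ℝ) * levySymbol a lam k) := by
    rw [← Complex.exp_add]
    push_cast
    ring_nf
  have e2 : Complex.exp ((2 * Real.pi * k * u : ℝ) * Complex.I) *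
      (Complex.exp (((s + h : ℝ≥0) : ℝ) * levySymbol a lam k) * 𝓕 (φ : ℝ → ℂ) k) -
      Complex.exp ((2 * Real.pi * k * u : ℝ) * Complex.I) *
      (Complex.exp ((s : ℝ) * levySymbol a lam k) * 𝓕 (φ : ℝ → ℂ) k) -
      (h : ℝ) * (Complex.exp ((2 * Real.pi * k * u : ℝ) * Complex.I) *
      (Complex.exp ((s : ℝ) * levySymbol a lam k) * (levySymbol a lam k * 𝓕 (φ : ℝ → ℂ) k))) =
      Complex.exp ((2 * Real.pi * k * u : ℝ) * Complex.I) *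
      (Complex.exp ((s : ℝ) * levySymbol a lam k) *
      ((Complex.exp ((h : ℝ) * levySymbol a lam k) - 1 - (h : ℝ) * levySymbol a lam k) *
        𝓕 (φ : ℝ → ℂ) k)) := by
    rw [e]; ring
  rw [e2, norm_mul, norm_mul, norm_mul, Complex.norm_exp_ofReal_mul_I, one_mul]
  have h1 := norm_exp_mul_levySymbol_le ha hlam s k
  have h2 := Complex.norm_exp_sub_one_sub_le_of_re_nonpos (re_mul_levySymbol_nonpos ha hlam h k)
  calc _ ≤ 1 * (‖((h : ℝ) * levySymbol a lam k : ℂ)‖ ^ 2 * ‖𝓕 (φ : ℝ → ℂ) k‖) := by gcongr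
    _ = _ := by
      rw [norm_mul, norm_mul, norm_mul, Complex.norm_real, Real.norm_of_nonneg h.coe_nonneg]
      ring

end Semigroup

/-! ### The generator -/

theorem norm_div_sub_eq {t : ℝ≥0} (ht : 0 < t) (A B : ℂ) :
    ‖A / ((t : ℝ) : ℂ) - B‖ = ‖A - (t : ℝ) * B‖ / t := by
  have h0 : ((t : ℝ) : ℂ) ≠ 0 := by exact_mod_cast ht.ne'
  have : A / ((t : ℝ) : ℂ) - B = (A - (t : ℝ) * B) / ((t : ℝ) : ℂ) := by field_simp
  rw [this, norm_div, Complex.norm_real, Real.norm_of_nonneg t.coe_nonneg]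

section Generator

variable {a lam : ℝ} {Ω : Type*} [MeasurableSpace Ω] {P : Measure Ω} [IsProbabilityMeasure P]
  {X : ℝ≥0 → Ω → ℝ}

theorem HasSymbol.integral_zero (hX : HasSymbol a lam X P) (hm : ∀ t, Measurable (X t))
    (φ : 𝓢(ℝ, ℂ)) (u : ℝ) : ∫ ω, φ (u + X 0 ω) ∂P = φ u := by
  rw [hX.integral_comp_add hm, φ.eq_integral_fourier u]
  simp

variable (ha : 0 < a) (hlam : 0 < lam)
include ha hlam

theorem HasSymbol.exists_taylor_bound (hX : HasSymbol a lam X P) (hm : ∀ t, Measurable (X t))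
    (φ : 𝓢(ℝ, ℂ)) : ∃ M : ℝ, 0 ≤ M ∧ ∀ (s h : ℝ≥0) (u : ℝ),
      ‖(∫ ω, φ (u + X (s + h) ω) ∂P) - (∫ ω, φ (u + X s ω) ∂P)
        - (h : ℝ) * ∫ ω, levyOpSchwartz a lam φ (u + X s ω) ∂P‖ ≤ (h : ℝ) ^ 2 * M :=
  ⟨_, integral_nonneg fun _ => norm_nonneg _, hX.norm_integral_add_sub_le ha hlam hm φ⟩

/-- Mean value inequality for the transition semigroup. -/
theorem HasSymbol.norm_sub_sub_le (hX : HasSymbol a lam X P) (hm : ∀ t, Measurable (X t))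
    (φ : 𝓢(ℝ, ℂ)) {t : ℝ≥0} {u C : ℝ} {z : ℂ}
    (hC : ∀ s ≤ t, ‖(∫ ω, levyOpSchwartz a lam φ (u + X s ω) ∂P) - z‖ ≤ C) :
    ‖(∫ ω, φ (u + X t ω) ∂P) - φ u - (t : ℝ) * z‖ ≤ t * C := by
  obtain ⟨M, hM, hTaylor⟩ := hX.exists_taylor_bound ha hlam hm φ
  have key : ∀ n : ℕ, 0 < n → ‖(∫ ω, φ (u + X t ω) ∂P) - φ u - (t : ℝ) * z‖ ≤
      t * C + (t : ℝ) ^ 2 * M / n := by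
    intro n hn
    have hn' : (n : ℝ) ≠ 0 := by exact_mod_cast hn.ne'
    -- Over n steps of length t/n the Taylor errors add up to n (t/n)² M, which tends to 0.
    set h : ℝ≥0 := t / n with hh
    have hnh : (n : ℝ≥0) * h = t := by rw [hh]; field_simp
    have hstep : ∀ j : ℕ, j ≤ n →
        ‖(∫ ω, φ (u + X (j * h) ω) ∂P) - φ u - ((j * h : ℝ≥0) : ℝ) * z‖ ≤
          j * (h * C + (h : ℝ) ^ 2 * M) := by
      intro j
      induction j with
      | zero => intro _; simp [hX.integral_zero hm]
      | succ j ih =>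
        intro hj
        have ih := ih (by omega)
        have hle : (j : ℝ≥0) * h ≤ t := by
          rw [← hnh]
          gcongr
          omega
        have h1 := hTaylor (j * h) h u
        have h2 := hC _ hle
        have e : ((j + 1 : ℕ) : ℝ≥0) * h = j * h + h := by push_cast; ring
        rw [e]
        set A := ∫ ω, φ (u + X (j * h + h) ω) ∂P
        set B := ∫ ω, φ (u + X (j * h) ω) ∂P
        set D := ∫ ω, levyOpSchwartz a lam φ (u + X (j * h) ω) ∂P
        have e2 : A - φ u - ((j * h + h : ℝ≥0) : ℝ) * z =
            (B - φ u - ((j * h : ℝ≥0) : ℝ) * z) + (A - B - (h : ℝ) * D) + (h : ℝ) * (D - z) := by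
          push_cast; ring
        have h3 : ‖((h : ℝ) : ℂ) * (D - z)‖ ≤ h * C := by
          rw [norm_mul, Complex.norm_real, Real.norm_of_nonneg h.coe_nonneg]
          gcongr
        rw [e2]
        refine (norm_add₃_le).trans ?_
        have e3 : ((j + 1 : ℕ) : ℝ) * (h * C + (h : ℝ) ^ 2 * M) =
            j * (h * C + (h : ℝ) ^ 2 * M) + (h : ℝ) ^ 2 * M + h * C := by push_cast; ring
        rw [e3]
        linarith
    have h1 := hstep n le_rfl
    rw [hnh] at h1
    refine h1.trans (le_of_eq ?_)
    rw [hh]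
    push_cast
    field_simp
  have hlim : Tendsto (fun n : ℕ => (t : ℝ) * C + (t : ℝ) ^ 2 * M / n) atTop (𝓝 (t * C + 0)) :=
    tendsto_const_nhds.add (tendsto_const_div_atTop_nhds_zero_nat _)
  rw [add_zero] at hlim
  exact ge_of_tendsto hlim ((eventually_gt_atTop 0).mono fun n hn => key n hn)

theorem HasSymbol.tendstoUniformly_schwartz (hX : HasSymbol a lam X P)
    (hm : ∀ t, Measurable (X t)) (φ : 𝓢(ℝ, ℂ)) :
    TendstoUniformly (fun (t : ℝ≥0) (u : ℝ) => ((∫ ω, φ (u + X t ω) ∂P) - φ u) / ((t : ℝ) : ℂ))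
      (levyOpSchwartz a lam φ) (𝓝[>] 0) := by
  obtain ⟨M, hM, hTaylor⟩ := hX.exists_taylor_bound ha hlam hm φ
  rw [Metric.tendstoUniformly_iff]
  intro ε hε
  have hδ : (0 : ℝ) < ε / (M + 1) := by positivity
  have hmem : Set.Ioo (0 : ℝ≥0) ⟨ε / (M + 1), hδ.le⟩ ∈ 𝓝[>] (0 : ℝ≥0) := Ioo_mem_nhdsGT hδ
  filter_upwards [hmem] with t ht u
  have ht0 : (0 : ℝ) < t := ht.1
  have ht1 : (t : ℝ) < ε / (M + 1) := ht.2
  have h := hTaylor 0 t u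
  rw [zero_add, hX.integral_zero hm, hX.integral_zero hm] at h
  rw [dist_comm, dist_eq_norm, norm_div_sub_eq ht.1, div_lt_iff₀ ht0]
  refine h.trans_lt ?_
  rw [lt_div_iff₀ (by positivity)] at ht1
  nlinarith

/-- Strong continuity of the transition semigroup on `C₀`. -/
theorem HasSymbol.exists_norm_sub_le (hX : HasSymbol a lam X P) (hm : ∀ t, Measurable (X t))
    (g : C₀(ℝ, ℂ)) {ε : ℝ} (hε : 0 < ε) :
    ∃ δ : ℝ≥0, 0 < δ ∧ ∀ t ≤ δ, ∀ u, ‖(∫ ω, g (u + X t ω) ∂P) - g u‖ ≤ ε := by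
  obtain ⟨φ, hφ⟩ := g.exists_schwartz_approx (ε := ε / 3) (by positivity)
  obtain ⟨M, hM⟩ := (levyOpSchwartz a lam φ).exists_norm_le
  obtain ⟨N, hN⟩ := φ.exists_norm_le
  have hM0 : 0 ≤ M := (norm_nonneg _).trans (hM 0)
  have hδ : (0 : ℝ) < ε / 3 / (M + 1) := by positivity
  refine ⟨⟨_, hδ.le⟩, hδ, fun t ht u => ?_⟩
  have ht : (t : ℝ) ≤ ε / 3 / (M + 1) := ht
  have h1 := norm_integral_comp_add_sub_le (P := P) (map_continuous g) φ.continuous g.norm_apply_le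
    hN hφ (hm t) u
  have h2 : ‖(∫ ω, φ (u + X t ω) ∂P) - φ u‖ ≤ t * M := by
    have := hX.norm_sub_sub_le ha hlam hm φ (t := t) (u := u) (C := M) (z := 0) fun s _ => by
      rw [sub_zero]
      exact norm_integral_comp_add_le hM _ u
    simpa using this
  have h3 := hφ u
  have h4 : (t : ℝ) * M ≤ ε / 3 := by
    rw [le_div_iff₀ (by positivity)] at ht
    nlinarith [t.coe_nonneg]
  have e : (∫ ω, g (u + X t ω) ∂P) - g u = ((∫ ω, g (u + X t ω) ∂P) - ∫ ω, φ (u + X t ω) ∂P) +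
      ((∫ ω, φ (u + X t ω) ∂P) - φ u) + (φ u - g u) := by ring
  rw [e]
  refine (norm_add₃_le).trans ?_
  rw [norm_sub_rev (φ u)]
  linarith

theorem HasSymbol.levyOpGraph_subset (hX : HasSymbol a lam X P) (hm : ∀ t, Measurable (X t)) :
    levyOpGraph a lam ⊆ generatorGraph X P := by
  rintro ⟨f, g⟩ ⟨φ, hf, hg⟩
  have hf' : (f : ℝ → ℂ) = φ := funext hf
  have hg' : (g : ℝ → ℂ) = levyOpSchwartz a lam φ := by
    rw [levyOpSchwartz_coe ha hlam]; exact funext hg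
  simp only [generatorGraph, Set.mem_ofPred_eq, hf', hg']
  exact hX.tendstoUniformly_schwartz ha hlam hm φ

theorem mem_levyOpGraph (φ : 𝓢(ℝ, ℂ)) :
    (φ.toZeroAtInfty, (levyOpSchwartz a lam φ).toZeroAtInfty) ∈ levyOpGraph a lam :=
  ⟨φ, fun _ => rfl, fun u => by rw [← levyOpSchwartz_coe ha hlam]; rfl⟩

/-- The mean value inequality does not involve the Taylor constant of the approximating Schwartz
function, so for fixed t it passes to the limit in the graph norm. -/
theorem HasSymbol.closure_levyOpGraph_subset (hX : HasSymbol a lam X P)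
    (hm : ∀ t, Measurable (X t)) : closure (levyOpGraph a lam) ⊆ generatorGraph X P := by
  rintro ⟨f, g⟩ hfg
  simp only [generatorGraph, Set.mem_ofPred_eq]
  rw [Metric.tendstoUniformly_iff]
  intro ε hε
  obtain ⟨δ, hδ, hgδ⟩ := hX.exists_norm_sub_le ha hlam hm g (half_pos hε)
  filter_upwards [Ioo_mem_nhdsGT hδ] with t ht u
  have ht0 : (0 : ℝ) < t := ht.1
  rw [dist_comm, dist_eq_norm, norm_div_sub_eq ht.1, div_lt_iff₀ ht0]
  refine lt_of_le_of_lt (b := t * (ε / 2)) ?_ (by nlinarith)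
  refine le_of_forall_pos_le_add fun η hη => ?_
  -- Replacing f by φ costs κ twice, and replacing g by 𝓛 φ costs tκ.
  set κ : ℝ := η / (2 + t) with hκ
  have hκ0 : 0 < κ := by positivity
  obtain ⟨⟨f₁, g₁⟩, ⟨φ, hf₁, hg₁⟩, hdist⟩ := Metric.mem_closure_iff.mp hfg κ hκ0
  rw [Prod.dist_eq, max_lt_iff] at hdist
  have hg₁' : ∀ x, g₁ x = levyOpSchwartz a lam φ x := fun x => by
    rw [levyOpSchwartz_coe ha hlam]; exact hg₁ x
  have hfφ : ∀ x, ‖f x - φ x‖ ≤ κ := fun x => by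
    rw [← hf₁ x]
    have := (f - f₁).norm_apply_le x
    rw [← dist_eq_norm] at this
    exact this.trans hdist.1.le
  have hgφ : ∀ x, ‖levyOpSchwartz a lam φ x - g x‖ ≤ κ := fun x => by
    rw [← hg₁' x, norm_sub_rev]
    have := (g - g₁).norm_apply_le x
    rw [← dist_eq_norm] at this
    exact this.trans hdist.2.le
  obtain ⟨N, hN⟩ := φ.exists_norm_le
  obtain ⟨M, hM⟩ := (levyOpSchwartz a lam φ).exists_norm_le
  have h1 : ‖(∫ ω, φ (u + X t ω) ∂P) - φ u - (t : ℝ) * g u‖ ≤ t * (κ + ε / 2) := by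
    refine hX.norm_sub_sub_le ha hlam hm φ fun s hs => ?_
    have h2 := norm_integral_comp_add_sub_le (P := P) (levyOpSchwartz a lam φ).continuous
      (map_continuous g) hM g.norm_apply_le hgφ (hm s) u
    have h3 := hgδ s (hs.trans ht.2.le) u
    exact (norm_sub_le_norm_sub_add_norm_sub _ _ _).trans (add_le_add h2 h3)
  have h4 := norm_integral_comp_add_sub_le (P := P) (map_continuous f) φ.continuous f.norm_apply_le
    hN hfφ (hm t) u
  have h5 := hfφ u
  have e : (∫ ω, f (u + X t ω) ∂P) - f u - (t : ℝ) * g u =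
      ((∫ ω, f (u + X t ω) ∂P) - ∫ ω, φ (u + X t ω) ∂P) +
      ((∫ ω, φ (u + X t ω) ∂P) - φ u - (t : ℝ) * g u) + (φ u - f u) := by ring
  have h6 : κ * (2 + t) = η := by rw [hκ]; field_simp
  rw [norm_sub_rev] at h5
  rw [e]
  refine (norm_add₃_le).trans ?_
  linarith

omit ha hlam in
/-- The generator is dissipative. -/
theorem norm_le_norm_sub_of_tendstoUniformly {f g : C₀(ℝ, ℂ)}
    (h : TendstoUniformly (fun (t : ℝ≥0) (u : ℝ) => ((∫ ω, f (u + X t ω) ∂P) - f u) / ((t : ℝ) : ℂ))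
      g (𝓝[>] 0)) : ‖f‖ ≤ ‖f - g‖ := by
  refine le_of_forall_pos_le_add fun η hη => ?_
  rw [Metric.tendstoUniformly_iff] at h
  obtain ⟨t, ht, ht0⟩ := ((h η hη).and self_mem_nhdsWithin).exists
  have ht0 : (0 : ℝ) < t := ht0
  set D : ℝ → ℂ := fun u => ((∫ ω, f (u + X t ω) ∂P) - f u) / ((t : ℝ) : ℂ) with hD
  have hpt : ∀ u, ‖f u‖ ≤ (‖f‖ + t * (‖f - g‖ + η)) / (1 + t) := fun u => by
    have h1 : ‖f u - D u‖ ≤ ‖f - g‖ + η := by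
      have e : f u - D u = (f - g) u + (g u - D u) := by
        rw [ZeroAtInftyContinuousMap.sub_apply]; ring
      rw [e]
      refine (norm_add_le _ _).trans (add_le_add ((f - g).norm_apply_le u) ?_)
      rw [← dist_eq_norm]
      exact (ht u).le
    -- Dissipativity comes from contractivity: with D = (P_t f - f)/t, solving for f leaves ‖P_t f‖
    -- ≤ ‖f‖ on the right.
    have h2 : ((1 + t : ℝ) : ℂ) * f u = (∫ ω, f (u + X t ω) ∂P) + (t : ℝ) * (f u - D u) := by
      have : ((t : ℝ) : ℂ) ≠ 0 := by exact_mod_cast ht0.ne'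
      simp only [hD]
      push_cast
      field_simp
      ring
    have h3 := congrArg norm h2
    rw [norm_mul, Complex.norm_real, Real.norm_of_nonneg (by positivity)] at h3
    rw [le_div_iff₀ (by positivity), mul_comm, h3]
    refine (norm_add_le _ _).trans (add_le_add (norm_integral_comp_add_le f.norm_apply_le _ u) ?_)
    rw [norm_mul, Complex.norm_real, Real.norm_of_nonneg ht0.le]
    gcongr
  have h4 := ZeroAtInftyContinuousMap.norm_le_of_forall (f := f) (by positivity) hpt
  rw [le_div_iff₀ (by positivity)] at h4
  have h5 : ‖f‖ * t ≤ t * (‖f - g‖ + η) := by linarith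
  rw [mul_comm] at h5
  exact le_of_mul_le_mul_left h5 ht0

/-- The range of `1 - 𝓛` is the Schwartz space. -/
theorem exists_sub_levyOpSchwartz_eq (χ : 𝓢(ℝ, ℂ)) :
    ∃ φ : 𝓢(ℝ, ℂ), ∀ u, φ u - levyOpSchwartz a lam φ u = χ u := by
  have hre := re_levySymbol_nonpos ha hlam
  have hR := (hasTemperateGrowth_levySymbol_and_resolvent ha hre).2
  refine ⟨SchwartzMap.fourierMultiplierCLM ℂ (fun k => (1 - levySymbol a lam k)⁻¹) χ, fun u => ?_⟩
  set φ := SchwartzMap.fourierMultiplierCLM ℂ (fun k => (1 - levySymbol a lam k)⁻¹) χ with hφ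
  rw [← sub_apply, (φ - levyOpSchwartz a lam φ).eq_integral_fourier,
    χ.eq_integral_fourier]
  refine integral_congr_ae (ae_of_all _ fun k => ?_)
  have h1 : 𝓕 (φ - levyOpSchwartz a lam φ : ℝ → ℂ) k =
      𝓕 (φ : ℝ → ℂ) k - 𝓕 (levyOpSchwartz a lam φ : ℝ → ℂ) k := by
    have := congrArg (fun ψ : 𝓢(ℝ, ℂ) => ψ k)
      (map_sub (SchwartzMap.fourierTransformCLM ℂ (V := ℝ) (E := ℂ)) φ (levyOpSchwartz a lam φ))
    exact this
  have hne : 1 - levySymbol a lam k ≠ 0 := fun h => by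
    have := congrArg Complex.re h
    simp only [Complex.sub_re, Complex.one_re, Complex.zero_re] at this
    linarith [hre k]
  have h2 : 𝓕 (φ - levyOpSchwartz a lam φ : ℝ → ℂ) k = 𝓕 (χ : ℝ → ℂ) k := by
    rw [h1, fourier_levyOpSchwartz ha hlam, hφ, SchwartzMap.fourier_fourierMultiplierCLM hR]
    field_simp
  exact congrArg _ h2

/-- For (f, g) in the generator, f - g is approximated by a Schwartz function χ = φ - 𝓛 φ.
Dissipativity applied to the difference with (φ, 𝓛 φ) bounds f - φ, hence g - 𝓛 φ. -/
theorem HasSymbol.generatorGraph_subset_closure (hX : HasSymbol a lam X P)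
    (hm : ∀ t, Measurable (X t)) : generatorGraph X P ⊆ closure (levyOpGraph a lam) := by
  rintro ⟨f, g⟩ hfg
  simp only [generatorGraph, Set.mem_ofPred_eq] at hfg
  rw [Metric.mem_closure_iff]
  intro ε hε
  obtain ⟨χ, hχ⟩ := (f - g).exists_schwartz_approx (ε := ε / 4) (by positivity)
  obtain ⟨φ, hφ⟩ := exists_sub_levyOpSchwartz_eq ha hlam χ
  refine ⟨_, mem_levyOpGraph ha hlam φ, ?_⟩
  set Φ := φ.toZeroAtInfty with hΦ
  set Γ := (levyOpSchwartz a lam φ).toZeroAtInfty with hΓ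
  have hsub : ‖(f - Φ) - (g - Γ)‖ ≤ ε / 4 := by
    refine ZeroAtInftyContinuousMap.norm_le_of_forall (by positivity) fun x => ?_
    have e : ((f - Φ) - (g - Γ)) x = (f - g) x - χ x := by
      rw [← hφ x]
      simp only [ZeroAtInftyContinuousMap.sub_apply, hΦ, hΓ, SchwartzMap.toZeroAtInfty_apply]
      ring
    rw [e]
    exact hχ x
  have hgen : TendstoUniformly (fun (t : ℝ≥0) (u : ℝ) =>
      ((∫ ω, (f - Φ) (u + X t ω) ∂P) - (f - Φ) u) / ((t : ℝ) : ℂ)) (g - Γ) (𝓝[>] 0) := by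
    have hi (t : ℝ≥0) (u : ℝ) (F : C₀(ℝ, ℂ)) : Integrable (fun ω => F (u + X t ω)) P :=
      Integrable.of_bound ((map_continuous F).measurable.comp
        ((hm t).const_add u)).aestronglyMeasurable ‖F‖ (ae_of_all _ fun ω => F.norm_apply_le _)
    have e : (fun (t : ℝ≥0) (u : ℝ) =>
        ((∫ ω, (f - Φ) (u + X t ω) ∂P) - (f - Φ) u) / ((t : ℝ) : ℂ)) =
        (fun (t : ℝ≥0) (u : ℝ) => ((∫ ω, f (u + X t ω) ∂P) - f u) / ((t : ℝ) : ℂ)) -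
        fun (t : ℝ≥0) (u : ℝ) => ((∫ ω, φ (u + X t ω) ∂P) - φ u) / ((t : ℝ) : ℂ) := by
      funext t u
      have h1 : ∫ ω, (f - Φ) (u + X t ω) ∂P =
          (∫ ω, f (u + X t ω) ∂P) - ∫ ω, φ (u + X t ω) ∂P := integral_sub (hi t u f) (hi t u Φ)
      have h2 : (f - Φ) u = f u - φ u := rfl
      simp only [Pi.sub_apply]
      rw [h1, h2]
      ring
    rw [e]
    exact TendstoUniformly.sub hfg (hX.tendstoUniformly_schwartz ha hlam hm φ)
  have hfΦ : ‖f - Φ‖ ≤ ε / 4 := (norm_le_norm_sub_of_tendstoUniformly hgen).trans hsub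
  have hgΓ : ‖g - Γ‖ ≤ ε / 4 + ε / 4 := by
    have e : g - Γ = (f - Φ) - ((f - Φ) - (g - Γ)) := by abel
    rw [e]
    exact (norm_sub_le _ _).trans (add_le_add hfΦ hsub)
  rw [Prod.dist_eq, max_lt_iff, dist_eq_norm, dist_eq_norm]
  constructor <;> linarith

end Generator

theorem HasLevyCharFun.hasSymbol {a lam : ℝ} (ha : 0 < a) (hlam : 0 < lam)
    {Q : Measure (ℝ≥0 → ℝ)} [IsProbabilityMeasure Q] (hQ : HasLevyCharFun Q (levyPi a lam)) :
    HasSymbol a lam (fun t (ω : ℝ≥0 → ℝ) => ω t) Q := by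
  have := sFinite_levyPi a lam
  intro t k
  have h := hQ.eval (integrable_sq_levyPi ha hlam) t (2 * Real.pi * k)
  have hm : Measurable fun ω : ℝ≥0 → ℝ => ω t := measurable_pi_apply t
  rw [charFun_apply_real, integral_map hm.aemeasurable
    (Continuous.aestronglyMeasurable (by fun_prop))] at h
  rw [levySymbol_eq_integral ha hlam, ← levyExponent, ← h]
  push_cast
  rfl

theorem proposition2p1 (a lam : ℝ) (ha : 0 < a) (hlam : 0 < lam) :
    -- the Schwartz space is invariant, and the Fourier transform of `𝓛 φ` is `symbol · 𝓕 φ`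
    (∀ φ : 𝓢(ℝ, ℂ), ∃ ψ : 𝓢(ℝ, ℂ), (ψ : ℝ → ℂ) = levyOp a lam φ ∧
      ∀ k : ℝ, 𝓕 (ψ : ℝ → ℂ) k = levySymbol a lam k * 𝓕 (φ : ℝ → ℂ) k) ∧
    -- so is the space of real-valued Schwartz functions
    (∀ φ : 𝓢(ℝ, ℂ), (∀ u, (φ u).im = 0) → ∀ u, (levyOp a lam φ u).im = 0) ∧
    -- `𝓛` generates a Lévy process: its closure is the generator of the Feller semigroup
    (∃ (Ω : Type) (_ : MeasurableSpace Ω) (P : Measure Ω) (X : ℝ≥0 → Ω → ℝ),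
      IsProbabilityMeasure P ∧ IsLevyProcess X P ∧
        levyOpGraph a lam ⊆ generatorGraph X P ∧
        closure (levyOpGraph a lam) = generatorGraph X P) ∧
    -- Lévy–Khintchine representation, with the Lévy measure `Π_a`
    IsLevyMeasure (levyPi a lam) ∧
    (∀ (φ : 𝓢(ℝ, ℂ)) (u : ℝ),
      Integrable (fun y : ℝ => φ (u - y) - φ u + (y : ℂ) * deriv (φ : ℝ → ℂ) u) (levyPi a lam) ∧
      levyOp a lam φ u =
        ∫ y : ℝ, (φ (u - y) - φ u + (y : ℂ) * deriv (φ : ℝ → ℂ) u) ∂(levyPi a lam)) := by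
  have hsf := sFinite_levyPi a lam
  have hΛ := integrable_sq_levyPi ha hlam
  refine ⟨fun φ => ⟨levyOpSchwartz a lam φ, levyOpSchwartz_coe ha hlam φ,
    fourier_levyOpSchwartz ha hlam φ⟩, levyOp_im_eq_zero ha hlam, ?_,
    isLevyMeasure_levyPi ha hlam, levyOp_eq_integral ha hlam⟩
  obtain ⟨Q, hQp, hQ⟩ := exists_hasLevyCharFun hΛ
  have hX := hQ.hasSymbol ha hlam
  have hL := hQ.isLevyProcess hΛ
  exact ⟨ℝ≥0 → ℝ, inferInstance, Q, fun t ω => ω t, hQp, hL,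
    hX.levyOpGraph_subset ha hlam hL.measurable,
    Set.Subset.antisymm (hX.closure_levyOpGraph_subset ha hlam hL.measurable)
      (hX.generatorGraph_subset_closure ha hlam hL.measurable)⟩
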